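/- Let $A$ be a quantum system of finite dimension $m=|A|\ge 1$, and let $X$ and $Z$ be conjugate observables on $A$, i.e. measurements in orthonormal bases $\{|x\rangle\}$ and $\{|z\rangle\}$ with $|\langle x|z\rangle|^2=1/m$ for all $x,z$. For a state $\rho_{ABC}$ with $B$, $C$ finite-dimensional, let $\psi_{XB}=\sum_x|x\rangle\langle x|\otimes\psi_x$ with $\psi_x=\mathrm{Tr}_{AC}[(|x\rangle\langle x|_A\otimes 1_{BC})\rho_{ABC}]$, and $\xi_{ZC}=\sum_z|z\rangle\langle z|\otimes\xi_z$ with $\xi_z=\mathrm{Tr}_{AB}[(|z\rangle\langle z|_A\otimes 1_{BC})\rho_{ABC}]$, be the classical-quantum states obtained by measuring $X$ (ignoring $C$), respectively $Z$ (ignoring $B$). For POVMs $\Lambda=(\Lambda_x)$ on $B$ and $\Gamma=(\Gamma_z)$ on $C$ put $P(X|B)_{\psi,\Lambda}=\sum_x\mathrm{Tr}[\psi_x\Lambda_x]$, $P(Z|C)_{\xi,\Gamma}=\sum_z\mathrm{Tr}[\xi_z\Gamma_z]$, and let $P_{\rm opt}(X|B)_\psi$, $P_{\rm opt}(Z|C)_\xi$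 be the suprema over all POVMs. Then: 1. For every state $\rho_{ABC}$, $$m\,P_{\rm opt}(Z|C)_\xi\le\Big(\sqrt{P_{\rm opt}(X|B)_\psi}+\sqrt{m-1}\,\sqrt{1-P_{\rm opt}(X|B)_\psi}\Big)^2 .$$ 2. Equality is attained. Fix outcomes $x_0,z_0$ and $p_0\in[1/m,1]$, let $P$ be the L distribution $P(x_0)=p_0$, $P(x)=(1-p_0)/(m-1)$ for $x\ne x_0$, and let $B$, $C$ be trivial and $|\theta\rangle_A=\sum_x\sqrt{P(x)}\,u_x|x\rangle$ with the phases $u_x=\sqrt m\,\langle x|z_0\rangle$. If $|z_0\rangle=m^{-1/2}\sum_x|x\rangle$, all $u_x=1$, so that $|\theta\rangle=\sum_x\sqrt{P(x)}|x\rangle$. Then $|\theta\rangle$ is a unit vector; always guessing $X=x_0$ and $Z=z_0$ is optimal; $P_{\rm opt}(X|B)=p_0$; and $m\,P_{\rm opt}(Z|C)=(\sqrt{p_0}+\sqrt{m-1}\sqrt{1-p_0})^2$. 3. The region is exact. For the given $X$ and $Z$, the set of pairs $(P_{\rm opt}(X|B)_\psi,P_{\rm opt}(Z|C)_\xi)$,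 over all finite-dimensional $B$, $C$ and all states $\rho_{ABC}$, is $$\mathcal R_m=\big\{(x,z)\in[1/m,1]^2:\ m z\le(\sqrt x+\sqrt{m-1}\sqrt{1-x})^2\big\},$$ and $\mathcal R_m$ is also the set of all pairs $(P(X|B)_{\psi,\Lambda},P(Z|C)_{\xi,\Gamma})$, over all $B$, $C$, $\rho_{ABC}$ and all POVMs $\Lambda,\Gamma$, for which both entries are at least $1/m$. 4. Let $m\ge2$ and $q_m(x,z)=\frac{(x+z-1)^2}{1/m}+\frac{(x-z)^2}{(m-1)/m}$. For $(x,z)\in[1/m,1]^2$, equality $mz=(\sqrt x+\sqrt{m-1}\sqrt{1-x})^2$ holds if and only if $q_m(x,z)=1$ and $x+z\ge1$; and $(x,z)\in\mathcal R_m$ if and only if $x+z\le1$ or $q_m(x,z)\le1$. 5. A nondegenerate ellipse in the plane is contained in the unit square $[0,1]^2$ and touches all four of its sides if and only if it is the ellipse $q_m=1$ for some real $m>1$. -/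

import Mathlib

open scoped ComplexOrder

/-- A density matrix: positive semidefinite with unit trace. -/
def IsState {ι : Type*} [Fintype ι] (ρ : Matrix ι ι ℂ) : Prop :=
  ρ.PosSemidef ∧ ρ.trace = 1

/-- The reduced state `ρ_AB = Tr_C ρ_ABC`. -/
def traceOutC {A B C : Type*} [Fintype C] (ρ : Matrix (A × B × C) (A × B × C) ℂ) :
    Matrix (A × B) (A × B) ℂ :=
  Matrix.of fun p q => ∑ c, ρ (p.1, p.2, c) (q.1, q.2, c)

/-- The reduced state `ρ_AC = Tr_B ρ_ABC`. -/
def traceOutB {A B C : Type*} [Fintype B] (ρ : Matrix (A × B × C) (A × B × C) ℂ) :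
    Matrix (A × C) (A × C) ℂ :=
  Matrix.of fun p q => ∑ b, ρ (p.1, b, p.2) (q.1, b, q.2)

/-- Measuring the system `A` of a state `σ` of `A` and `B` in the orthonormal basis `e`. The
resulting classical-quantum state `∑ x, |x⟩⟨x| ⊗ σ_x` is given by its (subnormalized) blocks
`σ_x = Tr_A[(|e_x⟩⟨e_x| ⊗ 1) σ] = ⟨e_x| σ |e_x⟩`. -/
noncomputable def measureA {A B : Type*} [Fintype A]
    (e : OrthonormalBasis A ℂ (EuclideanSpace ℂ A))
    (σ : Matrix (A × B) (A × B) ℂ) (x : A) : Matrix B B ℂ :=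
  Matrix.of fun b b' => ∑ a, ∑ a', star (e x a) * σ (a, b) (a', b') * e x a'

/-- `Λ` is a positive operator valued measure with outcomes in `X`. -/
def IsPOVM {X B : Type*} [Fintype X] [DecidableEq B]
    (Λ : X → Matrix B B ℂ) : Prop :=
  (∀ x, (Λ x).PosSemidef) ∧ ∑ x, Λ x = 1

/-- The probability `P(X|B)_{ψ,Λ} = ∑ x, Tr[ψ_x Λ_x]` of guessing `X` correctly with the
measurement `Λ` on `B`, for the classical-quantum state with blocks `ψ_x = p_x φ_x`. -/
noncomputable def guessProb {X B : Type*} [Fintype X] [Fintype B]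
    (ψ Λ : X → Matrix B B ℂ) : ℝ :=
  (∑ x, (ψ x * Λ x).trace).re

/-- The optimal guessing probability `P_opt(X|B)_ψ`: the supremum over all measurements on `B`.
For a classical-quantum state (and a nonempty alphabet) the set is nonempty and bounded by 1. -/
noncomputable def optGuessProb {X B : Type*} [Fintype X] [Fintype B] [DecidableEq B]
    (ψ : X → Matrix B B ℂ) : ℝ :=
  sSup {p : ℝ | ∃ Λ : X → Matrix B B ℂ, IsPOVM Λ ∧ guessProb ψ Λ = p}

/-- The trivial measurement that always outputs the guess `x₀`. -/
def constGuess {X B : Type*} [DecidableEq X] [DecidableEq B] (x₀ : X) : X → Matrix B B ℂ :=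
  fun x => if x = x₀ then 1 else 0

/-- Conjugate observables: the two eigenbases are mutually unbiased, `|⟨x|z⟩|² = 1/|A|`. -/
def Conjugate {A : Type*} [Fintype A]
    (X Z : OrthonormalBasis A ℂ (EuclideanSpace ℂ A)) : Prop :=
  ∀ x z, ‖inner ℂ (X x) (Z z)‖ ^ 2 = 1 / (Fintype.card A : ℝ)

/-- The right-hand side `(√x + √(m-1) √(1-x))²` of the tradeoff. -/
noncomputable def tradeoff (m x : ℝ) : ℝ :=
  (Real.sqrt x + Real.sqrt (m - 1) * Real.sqrt (1 - x)) ^ 2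

/-- The points `(x,z)` of `[1/m,1]²` with `m z ≤ (√x + √(m-1) √(1-x))²`. -/
def tradeoffRegion (m : ℝ) : Set (ℝ × ℝ) :=
  {p | p.1 ∈ Set.Icc (1 / m) 1 ∧ p.2 ∈ Set.Icc (1 / m) 1 ∧ m * p.2 ≤ tradeoff m p.1}

/-- The points `(x,z)` of `[1/m,1]²` with `m z = (√x + √(m-1) √(1-x))²`. -/
def tradeoffBoundary (m : ℝ) : Set (ℝ × ℝ) :=
  {p | p.1 ∈ Set.Icc (1 / m) 1 ∧ p.2 ∈ Set.Icc (1 / m) 1 ∧ m * p.2 = tradeoff m p.1}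

/-- The L distribution: weight `p₀` on `x₀`, the rest spread evenly over the other outcomes. -/
noncomputable def lDist {A : Type*} [Fintype A] [DecidableEq A] (x₀ : A) (p₀ : ℝ) (x : A) : ℝ :=
  if x = x₀ then p₀ else (1 - p₀) / ((Fintype.card A : ℝ) - 1)

/-- The vector with amplitudes `√(lDist x)` in the basis `X`, the phases of the basis vectors
being fixed by those of `|z₀⟩`: for conjugate `X`, `Z` the numbers `√|A| ⟨x|z₀⟩` have modulus one.
They are all equal to one if `|z₀⟩ = |A|^{-1/2} ∑ x, |x⟩`. -/
noncomputable def lState {A : Type*} [Fintype A] [DecidableEq A]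
    (X Z : OrthonormalBasis A ℂ (EuclideanSpace ℂ A)) (x₀ z₀ : A) (p₀ : ℝ) :
    EuclideanSpace ℂ A :=
  ∑ x, (((Real.sqrt (lDist x₀ p₀ x) : ℝ) : ℂ) *
    (((Real.sqrt (Fintype.card A : ℝ) : ℝ) : ℂ) * inner ℂ (X x) (Z z₀))) • X x

/-- The tripartite density matrix `|θ⟩⟨θ|_A` with trivial (one-dimensional) `B` and `C`. -/
def trivialExtension {A : Type*} [Fintype A] (θ : EuclideanSpace ℂ A) :
    Matrix (A × Unit × Unit) (A × Unit × Unit) ℂ :=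
  Matrix.of fun p q => θ p.1 * star (θ q.1)

/-- `(x+z-1)²/(1/m) + (x-z)²/((m-1)/m)`. -/
noncomputable def ellipseForm (m : ℝ) (p : ℝ × ℝ) : ℝ :=
  (p.1 + p.2 - 1) ^ 2 / (1 / m) + (p.1 - p.2) ^ 2 / ((m - 1) / m)

/-- The ellipse `(x+z-1)²/(1/m) + (x-z)²/((m-1)/m) = 1`. -/
def tradeoffEllipse (m : ℝ) : Set (ℝ × ℝ) :=
  {p | ellipseForm m p = 1}

/-- A nondegenerate ellipse in the plane: a level set of a positive definite quadratic form
around a center `(u, v)`. -/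
def IsEllipse (E : Set (ℝ × ℝ)) : Prop :=
  ∃ u v a b d : ℝ, 0 < a ∧ 0 < a * d - b ^ 2 ∧
    E = {p | a * (p.1 - u) ^ 2 + 2 * b * (p.1 - u) * (p.2 - v) + d * (p.2 - v) ^ 2 = 1}

/-- `E` just fits in the unit square: it is contained in it and touches each of the four sides. -/
def JustFitsUnitSquare (E : Set (ℝ × ℝ)) : Prop :=
  E ⊆ Set.Icc (0 : ℝ) 1 ×ˢ Set.Icc (0 : ℝ) 1 ∧
    (∃ p ∈ E, p.1 = 0) ∧ (∃ p ∈ E, p.1 = 1) ∧ (∃ p ∈ E, p.2 = 0) ∧ (∃ p ∈ E, p.2 = 1)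

/-! Guessing correctly is an effect on the whole system: `P = ∑ x, |x⟩⟨x| ⊗ Λ x ⊗ 1` and `Q = ∑ z,
|z⟩⟨z| ⊗ 1 ⊗ Γ z`, with `p = Tr ρP` and `q = Tr ρQ`. Conjugacy gives `Q P Q ≤ Q / m`
(`guessEffect_complementarity`). Splitting `Q = Q P + Q (1 - P)`, Cauchy–Schwarz and `Q² ≤ Q` yield
`q ≤ √s √p + √(q - s) √(1 - p)` with `s = Tr ρQPQ ≤ q / m`. After division by `√q` the right side is
the cosine of a difference of two angles, monotone in `s / q ≤ 1/m ≤ p`; this is the bound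
(`guessProb_tradeoff`), and closedness carries it to the suprema.

The L state saturates it: its phases make the amplitudes at `z₀` add without cancellation. Mixing in
its `X`-dephasing keeps the `X` statistics and moves those of `Z` towards uniform, so every lower
point of the region is reached too.

For fixed `x` the ellipse equation is quadratic in `z`, and the tradeoff curve is its upper root. An
ellipse fitting the square has centre and both half-widths `1/2`, which leaves one parameter. -/

open Matrix Kronecker

/-! ### Guessing probabilities as expectations of effects -/

/-- The rank-one projection `|e_x⟩⟨e_x|`. -/
noncomputable def basisProj {A : Type*} [Fintype A]
    (e : OrthonormalBasis A ℂ (EuclideanSpace ℂ A)) (x : A) : Matrix A A ℂ :=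
  Matrix.of fun a a' => e x a * star (e x a')

theorem basisProj_posSemidef {A : Type*} [Fintype A]
    (e : OrthonormalBasis A ℂ (EuclideanSpace ℂ A)) (x : A) : (basisProj e x).PosSemidef :=
  Matrix.posSemidef_vecMulVec_self_star (fun a => e x a)

theorem sum_basisProj {A : Type*} [Fintype A] [DecidableEq A]
    (e : OrthonormalBasis A ℂ (EuclideanSpace ℂ A)) : ∑ x, basisProj e x = 1 := by
  ext a a'
  have h := e.sum_inner_mul_inner (EuclideanSpace.single a (1 : ℂ)) (EuclideanSpace.single a' 1)
  simp only [EuclideanSpace.inner_single_left, EuclideanSpace.inner_single_right] at h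
  simp [Matrix.sum_apply, basisProj, Matrix.one_apply] at h ⊢
  rw [h]
  simp [eq_comm]

theorem inner_eq_sum {A : Type*} [Fintype A] (u v : EuclideanSpace ℂ A) :
    inner ℂ u v = ∑ a, star (u a) * v a := by
  simp [PiLp.inner_apply, mul_comm]

/-- A rank-one projection compresses any operator to a scalar, here `|⟨x|z⟩|²`. This is the only
place where conjugacy enters the upper bound. -/
theorem basisProj_mul_mul {A : Type*} [Fintype A]
    {X Z : OrthonormalBasis A ℂ (EuclideanSpace ℂ A)} (hXZ : Conjugate X Z) (x z : A) :
    basisProj Z z * basisProj X x * basisProj Z z =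
      ((1 / (Fintype.card A : ℝ) : ℝ) : ℂ) • basisProj Z z := by
  have h : inner ℂ (Z z) (X x) * inner ℂ (X x) (Z z) = ((1 / (Fintype.card A : ℝ) : ℝ) : ℂ) := by
    rw [← hXZ x z, ← inner_conj_symm (Z z) (X x), Complex.conj_mul']
    norm_cast
  have e1 : basisProj Z z * basisProj X x * basisProj Z z =
      (inner ℂ (Z z) (X x) * inner ℂ (X x) (Z z)) • basisProj Z z := by
    ext a a'
    simp only [Matrix.mul_apply, basisProj, Matrix.of_apply, Matrix.smul_apply, smul_eq_mul,
      inner_eq_sum, Finset.sum_mul, Finset.mul_sum]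
    refine Finset.sum_congr rfl fun i _ => Finset.sum_congr rfl fun j _ => ?_
    ring
  rw [e1, h]

theorem IsPOVM.one_sub_posSemidef {A D : Type*} [Fintype A] [DecidableEq A] [DecidableEq D]
    {M : A → Matrix D D ℂ} (hM : IsPOVM M) (x : A) : (1 - M x).PosSemidef := by
  rw [← hM.2, ← Finset.sum_erase_eq_sub (Finset.mem_univ x)]
  exact Matrix.posSemidef_sum _ fun i _ => hM.1 i

/-- The effect `∑ x, |e_x⟩⟨e_x| ⊗ M_x` of guessing correctly. -/
noncomputable def guessEffect {A D : Type*} [Fintype A]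
    (e : OrthonormalBasis A ℂ (EuclideanSpace ℂ A)) (M : A → Matrix D D ℂ) :
    Matrix (A × D) (A × D) ℂ :=
  ∑ x, basisProj e x ⊗ₖ M x

theorem guessEffect_posSemidef {A D : Type*} [Fintype A] [Fintype D] [DecidableEq D]
    (e : OrthonormalBasis A ℂ (EuclideanSpace ℂ A)) {M : A → Matrix D D ℂ} (hM : IsPOVM M) :
    (guessEffect e M).PosSemidef :=
  Matrix.posSemidef_sum _ fun x _ => (basisProj_posSemidef e x).kronecker (hM.1 x)

/-- As the projections sum to one, the complement is the same kind of sum with each `M x` replaced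
by `1 - M x`. -/
theorem one_sub_guessEffect_posSemidef {A D : Type*} [Fintype A] [DecidableEq A] [Fintype D]
    [DecidableEq D] (e : OrthonormalBasis A ℂ (EuclideanSpace ℂ A)) {M : A → Matrix D D ℂ}
    (hM : IsPOVM M) : (1 - guessEffect e M).PosSemidef := by
  have h : 1 - guessEffect e M = ∑ x, basisProj e x ⊗ₖ (1 - M x) := by
    have h1 : ∀ x, basisProj e x ⊗ₖ (1 - M x) = basisProj e x ⊗ₖ 1 - basisProj e x ⊗ₖ M x := by
      intro x
      ext ⟨a, b⟩ ⟨a', b'⟩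
      simp [Matrix.kroneckerMap_apply, mul_sub]
    have h2 : ∑ x, basisProj e x ⊗ₖ (1 : Matrix D D ℂ) = 1 := by
      rw [← Matrix.one_kronecker_one, ← sum_basisProj e]
      ext ⟨a, b⟩ ⟨a', b'⟩
      simp [Matrix.kroneckerMap_apply, Matrix.sum_apply, Finset.sum_mul]
    simp_rw [h1]
    rw [Finset.sum_sub_distrib, h2, guessEffect]
  rw [h]
  exact Matrix.posSemidef_sum _ fun x _ =>
    (basisProj_posSemidef e x).kronecker (hM.one_sub_posSemidef x)

theorem IsPOVM.kronecker_one {X B C : Type*} [Fintype X] [Fintype B] [Fintype C] [DecidableEq B]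
    [DecidableEq C] {Λ : X → Matrix B B ℂ} (h : IsPOVM Λ) :
    IsPOVM fun x => Λ x ⊗ₖ (1 : Matrix C C ℂ) := by
  refine ⟨fun x => (h.1 x).kronecker Matrix.PosSemidef.one, ?_⟩
  rw [← Matrix.one_kronecker_one, ← h.2]
  ext ⟨a, b⟩ ⟨a', b'⟩
  simp [Matrix.kroneckerMap_apply, Matrix.sum_apply, Finset.sum_mul]

theorem IsPOVM.one_kronecker {X B C : Type*} [Fintype X] [Fintype B] [Fintype C] [DecidableEq B]
    [DecidableEq C] {Γ : X → Matrix C C ℂ} (h : IsPOVM Γ) :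
    IsPOVM fun x => (1 : Matrix B B ℂ) ⊗ₖ Γ x := by
  refine ⟨fun x => Matrix.PosSemidef.one.kronecker (h.1 x), ?_⟩
  rw [← Matrix.one_kronecker_one, ← h.2]
  ext ⟨a, b⟩ ⟨a', b'⟩
  simp [Matrix.kroneckerMap_apply, Matrix.sum_apply, Finset.mul_sum]

theorem guessProb_traceOutC {A B C : Type*} [Fintype A] [Fintype B] [Fintype C]
    [DecidableEq C] (e : OrthonormalBasis A ℂ (EuclideanSpace ℂ A))
    (ρ : Matrix (A × B × C) (A × B × C) ℂ) (Λ : A → Matrix B B ℂ) :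
    guessProb (measureA e (traceOutC ρ)) Λ =
      (ρ * guessEffect e fun x => Λ x ⊗ₖ (1 : Matrix C C ℂ)).trace.re := by
  rw [guessProb, guessEffect, Matrix.mul_sum, Matrix.trace_sum]
  congr 2
  ext x
  simp only [Matrix.trace, Matrix.diag_apply, Matrix.mul_apply, measureA, traceOutC,
    Matrix.of_apply, Fintype.sum_prod_type, Matrix.kroneckerMap_apply, basisProj,
    Matrix.one_apply, mul_ite, mul_one, mul_zero, Finset.sum_ite_eq', Finset.mem_univ, if_true,
    Finset.sum_mul, Finset.mul_sum]
  -- Exchanges the order of five finite sums at once, by reindexing over a product type.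
  have s1 : ∀ f : B → B → A → A → C → ℂ,
      ∑ b, ∑ b', ∑ a, ∑ a', ∑ c, f b b' a a' c = ∑ a, ∑ b, ∑ c, ∑ a', ∑ b', f b b' a a' c := by
    intro f
    have h := Fintype.sum_equiv
      (⟨fun y => ((((y.1.1.2, y.1.1.1.1), y.2), y.1.2), y.1.1.1.2),
        fun y => ((((y.1.1.1.2, y.2), y.1.1.1.1), y.1.2), y.1.1.2), fun _ => rfl, fun _ => rfl⟩ :
        (((B × B) × A) × A) × C ≃ (((A × B) × C) × A) × B)
      (fun y => f y.1.1.1.1 y.1.1.1.2 y.1.1.2 y.1.2 y.2)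
      (fun y => f y.1.1.1.2 y.2 y.1.1.1.1 y.1.2 y.1.1.2) fun _ => rfl
    simpa only [Fintype.sum_prod_type] using h
  rw [s1]
  refine Finset.sum_congr rfl fun a _ => Finset.sum_congr rfl fun b _ =>
    Finset.sum_congr rfl fun c _ => Finset.sum_congr rfl fun a' _ =>
    Finset.sum_congr rfl fun b' _ => ?_
  ring

theorem guessProb_traceOutB {A B C : Type*} [Fintype A] [Fintype B] [Fintype C]
    [DecidableEq B] (e : OrthonormalBasis A ℂ (EuclideanSpace ℂ A))
    (ρ : Matrix (A × B × C) (A × B × C) ℂ) (Γ : A → Matrix C C ℂ) :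
    guessProb (measureA e (traceOutB ρ)) Γ =
      (ρ * guessEffect e fun x => (1 : Matrix B B ℂ) ⊗ₖ Γ x).trace.re := by
  rw [guessProb, guessEffect, Matrix.mul_sum, Matrix.trace_sum]
  congr 2
  ext x
  simp only [Matrix.trace, Matrix.diag_apply, Matrix.mul_apply, measureA, traceOutB,
    Matrix.of_apply, Fintype.sum_prod_type, Matrix.kroneckerMap_apply, basisProj,
    Matrix.one_apply, ite_mul, one_mul, zero_mul, mul_ite, mul_zero, Finset.sum_mul,
    Finset.mul_sum]
  have s1 : ∀ f : C → C → A → A → B → ℂ,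
      ∑ c, ∑ c', ∑ a, ∑ a', ∑ b, f c c' a a' b = ∑ a, ∑ b, ∑ c, ∑ a', ∑ c', f c c' a a' b := by
    intro f
    have h := Fintype.sum_equiv
      (⟨fun y => ((((y.1.1.2, y.2), y.1.1.1.1), y.1.2), y.1.1.1.2),
        fun y => ((((y.1.1.2, y.2), y.1.1.1.1), y.1.2), y.1.1.1.2), fun _ => rfl, fun _ => rfl⟩ :
        (((C × C) × A) × A) × B ≃ (((A × B) × C) × A) × C)
      (fun y => f y.1.1.1.1 y.1.1.1.2 y.1.1.2 y.1.2 y.2)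
      (fun y => f y.1.1.2 y.2 y.1.1.1.1 y.1.2 y.1.1.1.2) fun _ => rfl
    simpa only [Fintype.sum_prod_type] using h
  rw [s1]
  refine Finset.sum_congr rfl fun a _ => Finset.sum_congr rfl fun b _ =>
    Finset.sum_congr rfl fun c _ => Finset.sum_congr rfl fun a' _ => ?_
  rw [Finset.sum_comm]
  refine Finset.sum_congr rfl fun c' _ => ?_
  rw [Finset.sum_ite_eq' Finset.univ b, if_pos (Finset.mem_univ b)]
  ring

/-! ### The complementarity inequality -/

/-- Complementarity of the two guessing effects: `Q P Q ≤ Q / |A|`. -/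
theorem guessEffect_complementarity {A B C : Type*} [Fintype A] [DecidableEq A] [Fintype B]
    [Fintype C] [DecidableEq B] [DecidableEq C]
    {X Z : OrthonormalBasis A ℂ (EuclideanSpace ℂ A)} (hXZ : Conjugate X Z)
    {Λ : A → Matrix B B ℂ} {Γ : A → Matrix C C ℂ} (hΛ : IsPOVM Λ) (hΓ : IsPOVM Γ)
    {P Q : Matrix (A × B × C) (A × B × C) ℂ}
    (hP : P = guessEffect X fun x => Λ x ⊗ₖ (1 : Matrix C C ℂ))
    (hQ : Q = guessEffect Z fun z => (1 : Matrix B B ℂ) ⊗ₖ Γ z) :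
    (((1 / (Fintype.card A : ℝ) : ℝ) : ℂ) • Q - Q * P * Q).PosSemidef := by
  set κ : ℂ := ((1 / (Fintype.card A : ℝ) : ℝ) : ℂ)
  set K : A → A → Matrix (A × B × C) (A × B × C) ℂ := fun x z => basisProj X x ⊗ₖ (Λ x ⊗ₖ Γ z)
  set Z' : A → Matrix (A × B × C) (A × B × C) ℂ := fun z => basisProj Z z ⊗ₖ 1
  have hK : ∀ x z, (K x z).PosSemidef := fun x z =>
    (basisProj_posSemidef X x).kronecker ((hΛ.1 x).kronecker (hΓ.1 z))
  have hQh : Q.IsHermitian := hQ ▸ (guessEffect_posSemidef Z hΓ.one_kronecker).1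
  have hZ' : ∀ z, (Z' z).IsHermitian := fun z =>
    ((basisProj_posSemidef Z z).kronecker Matrix.PosSemidef.one).1
  have k1 : ∑ x, ∑ z, K x z = P := by
    rw [hP, guessEffect]
    refine Finset.sum_congr rfl fun x _ => ?_
    rw [← hΓ.2]
    ext ⟨a, b, c⟩ ⟨a', b', c'⟩
    simp [K, Matrix.kroneckerMap_apply, Matrix.sum_apply, Finset.mul_sum]
  have k2 : ∑ x, ∑ z, K x z * Z' z = P * Q := by
    rw [hP, hQ, guessEffect, guessEffect, Finset.sum_mul_sum]
    simp [K, Z', ← Matrix.mul_kronecker_mul]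
  have k3 : ∑ x, ∑ z, Z' z * K x z = Q * P := by
    rw [hP, hQ, guessEffect, guessEffect, Finset.sum_mul_sum, Finset.sum_comm]
    simp [K, Z', ← Matrix.mul_kronecker_mul]
  -- By conjugacy each term is `κ |z⟩⟨z| ⊗ Λ x ⊗ Γ z`; summing over `x` removes `Λ`.
  have k4 : ∑ x, ∑ z, Z' z * K x z * Z' z = κ • Q := by
    rw [hQ, guessEffect, Finset.sum_comm, Finset.smul_sum]
    refine Finset.sum_congr rfl fun z _ => ?_
    simp only [K, Z', ← Matrix.mul_kronecker_mul, basisProj_mul_mul hXZ, mul_one, one_mul]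
    rw [← hΛ.2]
    ext ⟨a, b, c⟩ ⟨a', b', c'⟩
    simp [Matrix.kroneckerMap_apply, Matrix.sum_apply, Finset.mul_sum, Finset.sum_mul, mul_assoc, κ]
  -- A sum-of-squares certificate: by `k1`–`k4` the expansion is `QPQ - QPQ - QPQ + κ Q`.
  have key : κ • Q - Q * P * Q = ∑ x, ∑ z, (Q - Z' z)ᴴ * K x z * (Q - Z' z) := by
    have e1 : ∀ x z, (Q - Z' z)ᴴ * K x z * (Q - Z' z) =
        Q * K x z * Q - Q * (K x z * Z' z) - Z' z * K x z * Q + Z' z * K x z * Z' z := by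
      intro x z
      rw [Matrix.conjTranspose_sub, hQh.eq, (hZ' z).eq]
      noncomm_ring
    simp only [e1, Finset.sum_add_distrib, Finset.sum_sub_distrib, ← Finset.mul_sum,
      ← Finset.sum_mul, k1, k2, k3, k4]
    noncomm_ring
  rw [key]
  exact Matrix.posSemidef_sum _ fun x _ => Matrix.posSemidef_sum _ fun z _ =>
    (hK x z).conjTranspose_mul_mul_same _

/-! ### Scalar inequalities -/

/-- With `t = cos² α` and `p = cos² β` the base is `cos (α - β)`, and `hid` is `cos² = 1 - sin²`.
Raising `t` from `a` to `c ≤ p` brings `α` closer to `β`. -/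
theorem sq_sqrt_add_sqrt_mono {p a c : ℝ} (hp1 : p ≤ 1) (ha : 0 ≤ a) (hac : a ≤ c)
    (hcp : c ≤ p) :
    (√a * √p + √(1 - a) * √(1 - p)) ^ 2 ≤ (√c * √p + √(1 - c) * √(1 - p)) ^ 2 := by
  have hid : ∀ t : ℝ, 0 ≤ t → t ≤ 1 →
      (√t * √p + √(1 - t) * √(1 - p)) ^ 2 = 1 - (√(1 - t) * √p - √t * √(1 - p)) ^ 2 := by
    intro t h0 h1
    have e1 := Real.sq_sqrt h0
    have e2 := Real.sq_sqrt (sub_nonneg.2 h1)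
    have e3 := Real.sq_sqrt (ha.trans (hac.trans hcp))
    have e4 := Real.sq_sqrt (sub_nonneg.2 hp1)
    have : (√t * √p + √(1 - t) * √(1 - p)) ^ 2 + (√(1 - t) * √p - √t * √(1 - p)) ^ 2 =
        (√t ^ 2 + √(1 - t) ^ 2) * (√p ^ 2 + √(1 - p) ^ 2) := by ring
    rw [e1, e2, e3, e4] at this
    linarith
  have h0 : 0 ≤ √(1 - c) * √p - √c * √(1 - p) := by
    have h1 : √c * √(1 - p) ≤ √p * √(1 - c) :=
      mul_le_mul (Real.sqrt_le_sqrt hcp) (Real.sqrt_le_sqrt (by linarith))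
        (Real.sqrt_nonneg _) (Real.sqrt_nonneg _)
    linarith
  have h1 : √(1 - c) * √p - √c * √(1 - p) ≤ √(1 - a) * √p - √a * √(1 - p) :=
    sub_le_sub (mul_le_mul_of_nonneg_right (Real.sqrt_le_sqrt (by linarith)) (Real.sqrt_nonneg _))
      (mul_le_mul_of_nonneg_right (Real.sqrt_le_sqrt hac) (Real.sqrt_nonneg _))
  rw [hid a ha (by linarith), hid c (ha.trans hac) (by linarith)]
  exact sub_le_sub_left (pow_le_pow_left₀ h0 h1 2) 1

theorem tradeoff_eq {m : ℝ} (hm : 1 ≤ m) (p : ℝ) :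
    tradeoff m p = m * (√(1 / m) * √p + √(1 - 1 / m) * √(1 - p)) ^ 2 := by
  have h0 : 0 < m := by linarith
  have h1 : √m * √(1 / m) = 1 := by rw [← Real.sqrt_mul h0.le]; simp [h0.ne']
  have h2 : √m * √(1 - 1 / m) = √(m - 1) := by
    rw [← Real.sqrt_mul h0.le]
    congr 1
    field_simp
  calc tradeoff m p = (√m * √(1 / m) * √p + √m * √(1 - 1 / m) * √(1 - p)) ^ 2 := by
        rw [h1, h2, one_mul, tradeoff]
    _ = √m ^ 2 * (√(1 / m) * √p + √(1 - 1 / m) * √(1 - p)) ^ 2 := by ring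
    _ = _ := by rw [Real.sq_sqrt h0.le]

/-- Dividing `h` by `√q` bounds `√q` by the cosine belonging to `s / q` and `p`; monotonicity then
replaces `s / q` by `1 / m`. -/
theorem mul_le_tradeoff_of_le {m p q s : ℝ} (hm : 1 ≤ m) (hpm : 1 / m ≤ p) (hp1 : p ≤ 1)
    (hq : 0 ≤ q) (hs : 0 ≤ s) (hsq : s ≤ 1 / m * q)
    (h : q ≤ √s * √p + √(q - s) * √(1 - p)) : m * q ≤ tradeoff m p := by
  rw [tradeoff_eq hm]
  refine mul_le_mul_of_nonneg_left ?_ (by linarith)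
  rcases hq.eq_or_lt with rfl | hq0
  · positivity
  have ha : s / q ≤ 1 / m := (div_le_iff₀ hq0).2 hsq
  refine le_trans ?_ (sq_sqrt_add_sqrt_mono hp1 (div_nonneg hs hq) ha hpm)
  have e1 : √s = √q * √(s / q) := by
    rw [← Real.sqrt_mul hq, mul_div_cancel₀ _ hq0.ne']
  have e2 : √(q - s) = √q * √(1 - s / q) := by
    rw [← Real.sqrt_mul hq]
    congr 1
    field_simp
  rw [e1, e2] at h
  have hsq0 : 0 < √q := Real.sqrt_pos.2 hq0
  have h3 : √q ≤ √(s / q) * √p + √(1 - s / q) * √(1 - p) := by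
    refine le_of_mul_le_mul_left ?_ hsq0
    rw [Real.mul_self_sqrt hq]
    linarith
  calc q = √q ^ 2 := (Real.sq_sqrt hq).symm
    _ ≤ _ := pow_le_pow_left₀ hsq0.le h3 2

/-! ### The tradeoff curve as an arc of the ellipse -/

/-- Completes the square in `z`. By `tradeoff_expand` the tradeoff curve is the root with
nonnegative square root, so comparing it with the ellipse is a question about the sign of the
squared term. -/
theorem ellipseForm_sub_one {m : ℝ} (hm : 1 < m) (x z : ℝ) :
    (m - 1) * (ellipseForm m (x, z) - 1) =
      (m * z + (m - 2) * x - (m - 1)) ^ 2 - 4 * (m - 1) * (x * (1 - x)) := by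
  have h1 : m - 1 ≠ 0 := by linarith
  have h0 : m ≠ 0 := by linarith
  simp only [ellipseForm]
  field_simp
  ring

theorem tradeoff_expand {m x : ℝ} (hm : 1 ≤ m) (hx0 : 0 ≤ x) (hx1 : x ≤ 1) :
    tradeoff m x = (m - 1) - (m - 2) * x + √(4 * (m - 1) * (x * (1 - x))) := by
  have e1 := Real.sq_sqrt hx0
  have e2 := Real.sq_sqrt (sub_nonneg.2 hx1)
  have e3 := Real.sq_sqrt (sub_nonneg.2 hm)
  have e4 : √(4 * (m - 1) * (x * (1 - x))) = 2 * (√x * (√(m - 1) * √(1 - x))) := by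
    rw [Real.sqrt_eq_iff_mul_self_eq (mul_nonneg (by linarith)
      (mul_nonneg hx0 (sub_nonneg.2 hx1))) (by positivity)]
    calc 4 * (m - 1) * (x * (1 - x))
        = 4 * √(m - 1) ^ 2 * (√x ^ 2 * √(1 - x) ^ 2) := by rw [e1, e2, e3]
      _ = _ := by ring
  rw [tradeoff, add_sq, mul_pow, e1, e2, e3, e4]
  ring

/-- Above the antidiagonal, the points of the ellipse's complement or boundary in `[1/m,1]²` are
not below the middle line `m z + (m-2) x = m-1`. -/
theorem nonneg_of_sq_ge {m x z : ℝ} (hm : 2 ≤ m) (hx1 : x < 1)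
    (hz : 1 / m ≤ z) (hxz : 1 ≤ x + z)
    (hD : 4 * (m - 1) * (x * (1 - x)) ≤ (m * z + (m - 2) * x - (m - 1)) ^ 2) :
    0 ≤ m * z + (m - 2) * x - (m - 1) := by
  by_contra! hneg
  set D := m * z + (m - 2) * x - (m - 1) with hDdef
  have hmz : 1 ≤ m * z := by
    have := mul_le_mul_of_nonneg_left hz (by linarith : 0 ≤ m)
    rwa [mul_one_div_cancel (by linarith)] at this
  -- Two lower bounds for `D`, from `m z ≥ 1` and from `x + z ≥ 1`. For negative `D` both bound `D ^
  -- 2`.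
  have hD1 : -((m - 2) * (1 - x)) ≤ D := by rw [hDdef]; linarith
  have hD2 : -(2 * x - 1) ≤ D := by
    have : 0 ≤ m * (x + z - 1) := mul_nonneg (by linarith) (by linarith)
    rw [hDdef]; linarith
  have hx : 1 / 2 < x := by linarith
  have s1 : D ^ 2 ≤ ((m - 2) * (1 - x)) ^ 2 := sq_le_sq' hD1 (by linarith)
  have s2 : D ^ 2 ≤ (2 * x - 1) ^ 2 := sq_le_sq' hD2 (by linarith)
  have s3 : 4 * (m - 1) * x ≤ (m - 2) ^ 2 * (1 - x) := by
    refine le_of_mul_le_mul_right ?_ (sub_pos.2 hx1)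
    linarith [hD.trans s1]
  have s4 : 4 * m * (x * (1 - x)) ≤ 1 := by linarith [hD.trans s2]
  -- This is `s3` with `(m - 2)² + 4 (m - 1) = m²`. Together with `s6` it forces `8 (m - 1) ≤ m`,
  -- impossible for `m ≥ 2`.
  have s5 : 4 * (m - 1) ≤ m ^ 2 * (1 - x) := by linarith
  have s6 : 2 * m * (1 - x) ≤ 1 := by nlinarith
  nlinarith

theorem tradeoffBoundary_eq {m : ℝ} (hm : 2 ≤ m) :
    tradeoffBoundary m = {p | p.1 ∈ Set.Icc (1 / m) 1 ∧ p.2 ∈ Set.Icc (1 / m) 1 ∧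
      1 ≤ p.1 + p.2 ∧ p ∈ tradeoffEllipse m} := by
  ext ⟨x, z⟩
  simp only [tradeoffBoundary, tradeoffEllipse, Set.mem_ofPred_eq]
  refine and_congr_right fun hx => and_congr_right fun hz => ?_
  have hm0 : 0 < 1 / m := by positivity
  have hx0 : 0 < x := hm0.trans_le hx.1
  have hnn : 0 ≤ 4 * (m - 1) * (x * (1 - x)) :=
    mul_nonneg (by linarith) (mul_nonneg hx0.le (by linarith [hx.2]))
  have hE := ellipseForm_sub_one (by linarith : 1 < m) x z
  have hEq : ellipseForm m (x, z) = 1 ↔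
      4 * (m - 1) * (x * (1 - x)) = (m * z + (m - 2) * x - (m - 1)) ^ 2 := by
    constructor
    · intro h
      rw [h] at hE
      linarith
    · intro h
      have : (m - 1) * (ellipseForm m (x, z) - 1) = 0 := by rw [hE]; linarith
      rcases mul_eq_zero.1 this with h | h <;> linarith
  have hT : m * z = tradeoff m x ↔
      √(4 * (m - 1) * (x * (1 - x))) = m * z + (m - 2) * x - (m - 1) := by
    rw [tradeoff_expand (by linarith) hx0.le hx.2]
    constructor <;> intro h <;> linarith
  rw [hEq, hT]
  have hmx : 1 ≤ m * x := by
    have := mul_le_mul_of_nonneg_left hx.1 (by linarith : 0 ≤ m)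
    rwa [mul_one_div_cancel (by linarith)] at this
  constructor
  · intro h
    have hD0 : 0 ≤ m * z + (m - 2) * x - (m - 1) := h ▸ Real.sqrt_nonneg _
    have hsq : 4 * (m - 1) * (x * (1 - x)) = (m * z + (m - 2) * x - (m - 1)) ^ 2 := by
      rw [← h, Real.sq_sqrt hnn]
    refine ⟨?_, hsq⟩
    by_contra! hlt
    -- The left side is `m (x + z - 1) + 1 - 2 x`. It is nonnegative, so `x < 1/2`, whereas `h3` and
    -- `m x ≥ 1` give `x > 3/4`.
    have h1 : m * z + (m - 2) * x - (m - 1) < 1 - 2 * x := by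
      nlinarith
    have h2 := pow_lt_pow_left₀ h1 hD0 two_ne_zero
    have h3 : 4 * m * (x * (1 - x)) < 1 := by linarith
    nlinarith
  · rintro ⟨h1, h2⟩
    rw [h2, Real.sqrt_sq]
    rcases hx.2.eq_or_lt with rfl | hx1
    · have : (m * z + (m - 2) * 1 - (m - 1)) ^ 2 = 0 := by rw [← h2]; ring
      exact (pow_eq_zero_iff two_ne_zero).1 this |>.ge
    · exact nonneg_of_sq_ge hm hx1 hz.1 h1 h2.le

theorem tradeoffRegion_eq {m : ℝ} (hm : 2 ≤ m) :
    tradeoffRegion m = {p | p.1 ∈ Set.Icc (1 / m) 1 ∧ p.2 ∈ Set.Icc (1 / m) 1 ∧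
      (p.1 + p.2 ≤ 1 ∨ ellipseForm m p ≤ 1)} := by
  ext ⟨x, z⟩
  simp only [tradeoffRegion, Set.mem_ofPred_eq]
  refine and_congr_right fun hx => and_congr_right fun hz => ?_
  have hm0 : 0 < 1 / m := by positivity
  have hx0 : 0 < x := hm0.trans_le hx.1
  have hnn : 0 ≤ 4 * (m - 1) * (x * (1 - x)) :=
    mul_nonneg (by linarith) (mul_nonneg hx0.le (by linarith [hx.2]))
  have hE := ellipseForm_sub_one (by linarith : 1 < m) x z
  have hEq : ellipseForm m (x, z) ≤ 1 ↔
      (m * z + (m - 2) * x - (m - 1)) ^ 2 ≤ 4 * (m - 1) * (x * (1 - x)) := by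
    rw [← sub_nonpos, ← sub_nonpos (b := 4 * (m - 1) * (x * (1 - x))), ← hE]
    constructor
    · intro h
      exact mul_nonpos_of_nonneg_of_nonpos (by linarith) h
    · intro h
      exact nonpos_of_mul_nonpos_right h (by linarith)
  have hT : m * z ≤ tradeoff m x ↔
      m * z + (m - 2) * x - (m - 1) ≤ √(4 * (m - 1) * (x * (1 - x))) := by
    rw [tradeoff_expand (by linarith) hx0.le hx.2]
    constructor <;> intro h <;> linarith
  rw [hEq, hT]
  have hmul : ∀ t, 1 / m ≤ t → 1 ≤ m * t := by
    intro t ht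
    have := mul_le_mul_of_nonneg_left ht (by linarith : 0 ≤ m)
    rwa [mul_one_div_cancel (by linarith)] at this
  have hmx := hmul x hx.1
  have hmz := hmul z hz.1
  constructor
  · intro h
    by_contra! hcon
    obtain ⟨h1, h2⟩ := hcon
    have hD0 : 0 ≤ m * z + (m - 2) * x - (m - 1) := by
      rcases hx.2.eq_or_lt with rfl | hx1
      · linarith
      · exact nonneg_of_sq_ge hm hx1 hz.1 h1.le h2.le
    have := pow_le_pow_left₀ hD0 h 2
    rw [Real.sq_sqrt hnn] at this
    linarith
  · rintro (h | h)
    · have h1 : m * (x + z - 1) ≤ 0 := mul_nonpos_of_nonneg_of_nonpos (by linarith) (by linarith)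
      have h2 : m * z + (m - 2) * x - (m - 1) ≤ 1 - 2 * x := by linarith
      refine h2.trans ?_
      rcases le_total (1 - 2 * x) 0 with h0 | h0
      · exact h0.trans (Real.sqrt_nonneg _)
      · refine Real.le_sqrt_of_sq_le ?_
        -- The goal amounts to `1 ≤ 4 m x (1 - x)`, true because `m x ≥ 1` and `1 - x ≥ 1/2`.
        have : 0 ≤ (m * x - 1) * (1 - x) := mul_nonneg (by linarith) (by linarith [hx.2])
        nlinarith
    · exact Real.le_sqrt_of_sq_le h

/-! ### Ellipses that just fit in the unit square -/

theorem tradeoffEllipse_isEllipse {m : ℝ} (hm : 1 < m) : IsEllipse (tradeoffEllipse m) := by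
  have h0 : 0 < m := by linarith
  have h1 : 0 < m - 1 := by linarith
  have hΔ : m ^ 2 / (m - 1) * (m ^ 2 / (m - 1)) - (m * (m - 2) / (m - 1)) ^ 2 =
      4 * m ^ 2 / (m - 1) := by
    field_simp
    ring
  refine ⟨1 / 2, 1 / 2, m ^ 2 / (m - 1), m * (m - 2) / (m - 1), m ^ 2 / (m - 1),
    by positivity, hΔ ▸ by positivity, ?_⟩
  ext ⟨x, z⟩
  simp only [tradeoffEllipse, ellipseForm, Set.mem_ofPred_eq]
  have : (x + z - 1) ^ 2 / (1 / m) + (x - z) ^ 2 / ((m - 1) / m) =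
      m ^ 2 / (m - 1) * (x - 1 / 2) ^ 2 + 2 * (m * (m - 2) / (m - 1)) * (x - 1 / 2) * (z - 1 / 2) +
        m ^ 2 / (m - 1) * (z - 1 / 2) ^ 2 := by
    field_simp
    ring
  rw [this]

/-- On the ellipse `ellipseForm_sub_one` forces `x (1 - x) ≥ 0`, and symmetry in the coordinates
gives the rest. The contact points are where the completed square vanishes with `x = 0` or `x = 1`,
and their mirror images. -/
theorem tradeoffEllipse_justFits {m : ℝ} (hm : 1 < m) :
    JustFitsUnitSquare (tradeoffEllipse m) := by
  have h0 : m ≠ 0 := by linarith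
  have h1 : 0 < m - 1 := by linarith
  have h1' := h1.ne'
  have hswap : ∀ x z, ellipseForm m (z, x) = ellipseForm m (x, z) := by
    intro x z
    simp only [ellipseForm]
    rw [add_comm z x, ← neg_sub x z, neg_sq]
  have hIcc : ∀ x z, ellipseForm m (x, z) = 1 → x ∈ Set.Icc (0 : ℝ) 1 := by
    intro x z h
    have hE := ellipseForm_sub_one hm x z
    rw [h, sub_self, mul_zero] at hE
    have h2 : 0 ≤ (m - 1) * (x * (1 - x)) := by
      nlinarith [sq_nonneg (m * z + (m - 2) * x - (m - 1))]
    have h3 := nonneg_of_mul_nonneg_right h2 h1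
    constructor <;> nlinarith
  have e0 : ellipseForm m (0, 1 - 1 / m) = 1 := by
    simp only [ellipseForm]
    field_simp
    ring
  have e1 : ellipseForm m (1, 1 / m) = 1 := by
    simp only [ellipseForm]
    field_simp
    ring
  refine ⟨fun p hp => ⟨hIcc p.1 p.2 hp, hIcc p.2 p.1 ((hswap _ _).trans hp)⟩,
    ⟨_, e0, rfl⟩, ⟨_, e1, rfl⟩, ⟨(1 - 1 / m, 0), (hswap _ _).trans e0, rfl⟩,
    ⟨(1 / m, 1), (hswap _ _).trans e1, rfl⟩⟩

/-- An ellipse whose projection to the first coordinate is `[0,1]` has center `u = 1/2` and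
half-width `1/2`. -/
theorem center_and_width_of_fits {u v a b d : ℝ} (ha : 0 < a) (hΔ : 0 < a * d - b ^ 2)
    (hin : ∀ x z, a * (x - u) ^ 2 + 2 * b * (x - u) * (z - v) + d * (z - v) ^ 2 = 1 →
      x ∈ Set.Icc (0 : ℝ) 1)
    (h0 : ∃ z, a * (0 - u) ^ 2 + 2 * b * (0 - u) * (z - v) + d * (z - v) ^ 2 = 1)
    (h1 : ∃ z, a * (1 - u) ^ 2 + 2 * b * (1 - u) * (z - v) + d * (z - v) ^ 2 = 1) :
    u = 1 / 2 ∧ 4 * d = a * d - b ^ 2 := by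
  have hd : 0 < d := by
    by_contra! h
    nlinarith [sq_nonneg b, mul_nonneg ha.le (neg_nonneg.2 h)]
  -- The half-width: `d` times the form is `(b (x-u) + d (z-v))² + (a d - b²) (x-u)²`, so `|x - u|`
  -- is largest where the first square vanishes.
  set r := √(d / (a * d - b ^ 2)) with hr
  have hr2 : r ^ 2 = d / (a * d - b ^ 2) := Real.sq_sqrt (div_pos hd hΔ).le
  have hr0 : 0 ≤ r := Real.sqrt_nonneg _
  have hbound : ∀ x z, a * (x - u) ^ 2 + 2 * b * (x - u) * (z - v) + d * (z - v) ^ 2 = 1 →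
      |x - u| ≤ r := by
    intro x z h
    refine Real.abs_le_sqrt ?_
    rw [le_div_iff₀ hΔ]
    nlinarith [sq_nonneg (b * (x - u) + d * (z - v))]
  have hext : ∀ s, s ^ 2 = r ^ 2 → u + s ∈ Set.Icc (0 : ℝ) 1 := by
    intro s hs
    refine hin _ (v - b * s / d) ?_
    have e : a * (u + s - u) ^ 2 + 2 * b * (u + s - u) * (v - b * s / d - v) +
        d * (v - b * s / d - v) ^ 2 = s ^ 2 * ((a * d - b ^ 2) / d) := by
      field_simp
      ring
    rw [e, hs, hr2, div_mul_div_comm, mul_comm, div_self (mul_pos hΔ hd).ne']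
  have p1 := hext r rfl
  have p2 := hext (-r) (neg_sq r)
  obtain ⟨z0, hz0⟩ := h0
  obtain ⟨z1, hz1⟩ := h1
  have q0 := abs_le.1 (hbound _ _ hz0)
  have q1 := abs_le.1 (hbound _ _ hz1)
  have hu : u = 1 / 2 := by linarith [p1.1, p1.2, p2.1, p2.2, q0.1, q0.2, q1.1, q1.2]
  have hrv : r = 1 / 2 := by linarith [p1.1, p1.2, p2.1, p2.2, q0.1, q0.2, q1.1, q1.2]
  refine ⟨hu, ?_⟩
  rw [hrv, eq_div_iff hΔ.ne'] at hr2
  linarith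

/-- The two projections give `4 d = a d - b² = 4 a`, hence `a = d` and `(d + b)(d - b) = 4 d`. The
parameter `m = (d + b) / 2` is the coefficient of `(x + z - 1)²`; that of `(x - z)²` is then `m / (m
- 1)`. -/
theorem isEllipse_and_justFits_iff (E : Set (ℝ × ℝ)) :
    (IsEllipse E ∧ JustFitsUnitSquare E) ↔ ∃ m : ℝ, 1 < m ∧ E = tradeoffEllipse m := by
  constructor
  · rintro ⟨⟨u, v, a, b, d, ha, hΔ, rfl⟩, hsub, ⟨p0, hp0, hp0'⟩, ⟨p1, hp1, hp1'⟩,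
      ⟨p2, hp2, hp2'⟩, ⟨p3, hp3, hp3'⟩⟩
    have hd : 0 < d := by
      by_contra! h
      nlinarith [sq_nonneg b, mul_nonneg ha.le (neg_nonneg.2 h)]
    obtain ⟨hu, h4d⟩ := center_and_width_of_fits (u := u) (v := v) ha hΔ
      (fun x z h => (hsub (a := (x, z)) h).1) ⟨p0.2, hp0' ▸ hp0⟩ ⟨p1.2, hp1' ▸ hp1⟩
    have hsw : ∀ x z, d * (z - v) ^ 2 + 2 * b * (z - v) * (x - u) + a * (x - u) ^ 2 =
        a * (x - u) ^ 2 + 2 * b * (x - u) * (z - v) + d * (z - v) ^ 2 := fun x z => by ring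
    obtain ⟨hv, h4a⟩ := center_and_width_of_fits (u := v) (v := u) (b := b) hd
      (by linarith [mul_comm a d])
      (fun z x h => (hsub (a := (x, z)) ((hsw x z).symm.trans h)).2)
      ⟨p2.1, (hsw _ _).trans (hp2' ▸ hp2)⟩ ⟨p3.1, (hsw _ _).trans (hp3' ▸ hp3)⟩
    have had : d = a := by linarith [mul_comm a d]
    subst had hu hv
    have hprod : (d + b) * (d - b) = 4 * d := by linarith
    have hs : 0 < d + b := by
      by_contra! h
      nlinarith
    have ht : 0 < d - b := pos_of_mul_pos_right (by linarith) hs.le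
    have hm : 1 < (d + b) / 2 := by
      by_contra! h
      nlinarith
    refine ⟨(d + b) / 2, hm, ?_⟩
    have ht' : (d + b) / 2 / ((d + b) / 2 - 1) = (d - b) / 2 := by
      rw [div_eq_iff (by linarith)]
      linarith
    ext ⟨x, z⟩
    simp only [tradeoffEllipse, ellipseForm, Set.mem_ofPred_eq]
    have e : (x + z - 1) ^ 2 / (1 / ((d + b) / 2)) +
        (x - z) ^ 2 / (((d + b) / 2 - 1) / ((d + b) / 2)) =
        (d + b) / 2 * (x + z - 1) ^ 2 + (d - b) / 2 * (x - z) ^ 2 := by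
      rw [div_div_eq_mul_div, div_one, div_div_eq_mul_div, mul_div_assoc, ht']
      ring
    have e2 : d * (x - 1 / 2) ^ 2 + 2 * b * (x - 1 / 2) * (z - 1 / 2) + d * (z - 1 / 2) ^ 2 =
        (d + b) / 2 * (x + z - 1) ^ 2 + (d - b) / 2 * (x - z) ^ 2 := by ring
    rw [e, e2]
  · rintro ⟨m, hm, rfl⟩
    exact ⟨tradeoffEllipse_isEllipse hm, tradeoffEllipse_justFits hm⟩

/-! ### The tradeoff for fixed measurements -/

open scoped MatrixOrder in
theorem re_trace_mul_nonneg {ι : Type*} [Fintype ι] {ρ T : Matrix ι ι ℂ}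
    (hρ : ρ.PosSemidef) (hT : T.PosSemidef) : 0 ≤ (ρ * T).trace.re := by
  classical
  obtain ⟨R, rfl⟩ := CStarAlgebra.nonneg_iff_eq_star_mul_self.1 hρ.nonneg
  rw [Matrix.star_eq_conjTranspose, Matrix.mul_assoc, Matrix.trace_mul_comm]
  exact (Complex.nonneg_iff.1 (hT.mul_mul_conjTranspose_same R).trace_nonneg).1

/-- The Cauchy–Schwarz inequality for the state functional. -/
theorem re_trace_mul_mul_le {ι : Type*} [Fintype ι] {ρ P Q : Matrix ι ι ℂ}
    (hρ : ρ.PosSemidef) (hP : P.PosSemidef) (hQ : Q.IsHermitian) :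
    (ρ * (Q * P)).trace.re ≤ √(ρ * (Q * P * Q)).trace.re * √(ρ * P).trace.re := by
  classical
  have hsymm : (ρ * (P * Q)).trace.re = (ρ * (Q * P)).trace.re := by
    have h : (ρ * (P * Q)).trace = star (ρ * (Q * P)).trace := by
      rw [← Matrix.trace_conjTranspose, Matrix.conjTranspose_mul, Matrix.conjTranspose_mul,
        hρ.1.eq, hP.1.eq, hQ.eq, Matrix.trace_mul_comm]
    rw [h]
    rfl
  -- The polynomial is the expectation of `(Q - t) P (Q - t) ≥ 0`; its discriminant gives the
  -- inequality.
  have hquad : ∀ t : ℝ, 0 ≤ (ρ * P).trace.re * (t * t) + (-2 * (ρ * (Q * P)).trace.re) * t +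
      (ρ * (Q * P * Q)).trace.re := by
    intro t
    have h := re_trace_mul_nonneg hρ (hP.conjTranspose_mul_mul_same (Q - (t : ℂ) • 1))
    have e : ρ * ((Q - (t : ℂ) • 1)ᴴ * P * (Q - (t : ℂ) • 1)) =
        ρ * (Q * P * Q) - (t : ℂ) • (ρ * (Q * P)) - (t : ℂ) • (ρ * (P * Q)) +
          (t : ℂ) • (t : ℂ) • (ρ * P) := by
      rw [Matrix.conjTranspose_sub, hQ.eq, Matrix.conjTranspose_smul, Matrix.conjTranspose_one]
      simp only [sub_mul, mul_sub, Matrix.mul_smul, Matrix.smul_mul, mul_one, one_mul,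
        RCLike.star_def, Complex.conj_ofReal]
      abel
    rw [e] at h
    simp only [Matrix.trace_add, Matrix.trace_sub, Matrix.trace_smul, smul_eq_mul,
      Complex.add_re, Complex.sub_re, Complex.re_ofReal_mul, hsymm] at h
    linarith
  have hd := discrim_le_zero hquad
  rw [← Real.sqrt_mul (re_trace_mul_nonneg hρ (by
    simpa [hQ.eq] using hP.conjTranspose_mul_mul_same Q))]
  refine Real.le_sqrt_of_sq_le ?_
  rw [discrim] at hd
  linarith

theorem IsState.re_trace_mul_le_one {ι : Type*} [Fintype ι] [DecidableEq ι] {ρ T : Matrix ι ι ℂ}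
    (hρ : IsState ρ) (hT : (1 - T).PosSemidef) : (ρ * T).trace.re ≤ 1 := by
  have h := re_trace_mul_nonneg hρ.1 hT
  rw [mul_sub, mul_one, Matrix.trace_sub, hρ.2, Complex.sub_re, Complex.one_re] at h
  linarith

/-- Multiplying `Q (1 - Q)` by `Q + (1 - Q)` splits it into two congruences of positive matrices. -/
theorem posSemidef_sub_mul_self {ι : Type*} [Fintype ι] [DecidableEq ι] {Q : Matrix ι ι ℂ}
    (hQ : Q.PosSemidef) (hQ1 : (1 - Q).PosSemidef) : (Q - Q * Q).PosSemidef := by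
  have h1 := hQ1.conjTranspose_mul_mul_same Q
  have h2 := hQ.conjTranspose_mul_mul_same (1 - Q)
  rw [hQ.1.eq] at h1
  rw [hQ1.1.eq] at h2
  have e : Q - Q * Q = Q * (1 - Q) * Q + (1 - Q) * Q * (1 - Q) := by noncomm_ring
  rw [e]
  exact h1.add h2

section Tripartite

variable {A B C : Type*} [Fintype A] [DecidableEq A] [Fintype B] [DecidableEq B] [Fintype C]
  [DecidableEq C]

theorem guessProb_traceOutC_mem (e : OrthonormalBasis A ℂ (EuclideanSpace ℂ A))
    {ρ : Matrix (A × B × C) (A × B × C) ℂ} (hρ : IsState ρ) {Λ : A → Matrix B B ℂ}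
    (hΛ : IsPOVM Λ) : guessProb (measureA e (traceOutC ρ)) Λ ∈ Set.Icc (0 : ℝ) 1 := by
  rw [guessProb_traceOutC]
  exact ⟨re_trace_mul_nonneg hρ.1 (guessEffect_posSemidef e hΛ.kronecker_one),
    hρ.re_trace_mul_le_one (one_sub_guessEffect_posSemidef e hΛ.kronecker_one)⟩

theorem guessProb_traceOutB_mem (e : OrthonormalBasis A ℂ (EuclideanSpace ℂ A))
    {ρ : Matrix (A × B × C) (A × B × C) ℂ} (hρ : IsState ρ) {Γ : A → Matrix C C ℂ}
    (hΓ : IsPOVM Γ) : guessProb (measureA e (traceOutB ρ)) Γ ∈ Set.Icc (0 : ℝ) 1 := by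
  rw [guessProb_traceOutB]
  exact ⟨re_trace_mul_nonneg hρ.1 (guessEffect_posSemidef e hΓ.one_kronecker),
    hρ.re_trace_mul_le_one (one_sub_guessEffect_posSemidef e hΓ.one_kronecker)⟩

theorem one_le_card_real (A : Type*) [Fintype A] [Nonempty A] : (1 : ℝ) ≤ Fintype.card A := by
  exact_mod_cast (Fintype.card_pos : 0 < Fintype.card A)

/-- The tradeoff for given measurements. -/
theorem guessProb_tradeoff [Nonempty A] {X Z : OrthonormalBasis A ℂ (EuclideanSpace ℂ A)}
    (hXZ : Conjugate X Z) {ρ : Matrix (A × B × C) (A × B × C) ℂ} (hρ : IsState ρ)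
    {Λ : A → Matrix B B ℂ} {Γ : A → Matrix C C ℂ} (hΛ : IsPOVM Λ) (hΓ : IsPOVM Γ)
    (hp : 1 / (Fintype.card A : ℝ) ≤ guessProb (measureA X (traceOutC ρ)) Λ) :
    (Fintype.card A : ℝ) * guessProb (measureA Z (traceOutB ρ)) Γ ≤
      tradeoff (Fintype.card A) (guessProb (measureA X (traceOutC ρ)) Λ) := by
  have hp1 := (guessProb_traceOutC_mem X hρ hΛ).2
  have hq0 := (guessProb_traceOutB_mem Z hρ hΓ).1
  rw [guessProb_traceOutC] at hp hp1 ⊢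
  rw [guessProb_traceOutB] at hq0 ⊢
  set P := guessEffect X fun x => Λ x ⊗ₖ (1 : Matrix C C ℂ) with hPdef
  set Q := guessEffect Z fun z => (1 : Matrix B B ℂ) ⊗ₖ Γ z with hQdef
  have hP : P.PosSemidef := guessEffect_posSemidef X hΛ.kronecker_one
  have hP1 : (1 - P).PosSemidef := one_sub_guessEffect_posSemidef X hΛ.kronecker_one
  have hQ : Q.PosSemidef := guessEffect_posSemidef Z hΓ.one_kronecker
  have hQ1 : (1 - Q).PosSemidef := one_sub_guessEffect_posSemidef Z hΓ.one_kronecker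
  have hs0 := re_trace_mul_nonneg hρ.1 (hP.conjTranspose_mul_mul_same Q)
  rw [hQ.1.eq] at hs0
  have hs := re_trace_mul_nonneg hρ.1 (guessEffect_complementarity hXZ hΛ hΓ hPdef hQdef)
  rw [mul_sub, Matrix.mul_smul, Matrix.trace_sub, Matrix.trace_smul, Complex.sub_re, smul_eq_mul,
    Complex.re_ofReal_mul] at hs
  have hQQ := re_trace_mul_nonneg hρ.1 (posSemidef_sub_mul_self hQ hQ1)
  rw [mul_sub, Matrix.trace_sub, Complex.sub_re] at hQQ
  refine mul_le_tradeoff_of_le (one_le_card_real A) hp hp1 hq0 hs0 (by linarith) ?_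
  -- Cauchy–Schwarz for both halves of `Q = Q P + Q (1 - P)`; `Q² ≤ Q` bounds the second by `q - s`.
  have c1 := re_trace_mul_mul_le hρ.1 hP hQ.1
  have c2 := re_trace_mul_mul_le hρ.1 hP1 hQ.1
  have e1 : (ρ * (Q * (1 - P) * Q)).trace.re ≤
      (ρ * Q).trace.re - (ρ * (Q * P * Q)).trace.re := by
    have : ρ * (Q * (1 - P) * Q) = ρ * (Q * Q) - ρ * (Q * P * Q) := by noncomm_ring
    rw [this, Matrix.trace_sub, Complex.sub_re]
    linarith
  have e2 : (ρ * (1 - P)).trace.re = 1 - (ρ * P).trace.re := by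
    rw [mul_sub, mul_one, Matrix.trace_sub, hρ.2, Complex.sub_re, Complex.one_re]
  have e3 : (ρ * (Q * P)).trace.re + (ρ * (Q * (1 - P))).trace.re = (ρ * Q).trace.re := by
    rw [← Complex.add_re, ← Matrix.trace_add]
    congr 2
    noncomm_ring
  rw [e2] at c2
  have c3 := c2.trans (mul_le_mul_of_nonneg_right (Real.sqrt_le_sqrt e1) (Real.sqrt_nonneg _))
  linarith

/-! ### Blind guessing and passage to the suprema -/

/-- The measurement whose outcome is uniformly random. -/
noncomputable def uniformPOVM (A B : Type*) [Fintype A] [DecidableEq B] : A → Matrix B B ℂ :=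
  fun _ => ((1 / (Fintype.card A : ℝ) : ℝ) : ℂ) • 1

omit [DecidableEq A] [Fintype B] in
theorem uniformPOVM_isPOVM [Nonempty A] : IsPOVM (uniformPOVM A B) := by
  refine ⟨fun x => Matrix.PosSemidef.one.smul ?_, ?_⟩
  · exact_mod_cast (by positivity : (0 : ℝ) ≤ 1 / (Fintype.card A : ℝ))
  · have : (Fintype.card A : ℂ) ≠ 0 := by exact_mod_cast Fintype.card_ne_zero
    simp only [uniformPOVM, Finset.sum_const, Finset.card_univ, ← Nat.cast_smul_eq_nsmul ℂ,
      smul_smul]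
    push_cast
    rw [mul_one_div_cancel this, one_smul]

theorem guessEffect_uniform {D : Type*} [Fintype D] [DecidableEq D]
    (e : OrthonormalBasis A ℂ (EuclideanSpace ℂ A)) (c : ℂ) :
    guessEffect e (fun _ => c • (1 : Matrix D D ℂ)) = c • 1 := by
  rw [guessEffect, ← Matrix.one_kronecker_one, ← sum_basisProj e]
  ext ⟨a, b⟩ ⟨a', b'⟩
  simp [Matrix.kroneckerMap_apply, Matrix.sum_apply, Finset.sum_mul, Finset.mul_sum]
  exact Finset.sum_congr rfl fun _ _ => by ring

theorem guessProb_traceOutC_uniform (e : OrthonormalBasis A ℂ (EuclideanSpace ℂ A))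
    {ρ : Matrix (A × B × C) (A × B × C) ℂ} (hρ : IsState ρ) :
    guessProb (measureA e (traceOutC ρ)) (uniformPOVM A B) = 1 / (Fintype.card A : ℝ) := by
  rw [guessProb_traceOutC]
  simp only [uniformPOVM, Matrix.smul_kronecker, Matrix.one_kronecker_one, guessEffect_uniform]
  rw [Matrix.mul_smul, mul_one, Matrix.trace_smul, hρ.2, smul_eq_mul, mul_one, Complex.ofReal_re]

theorem guessProb_traceOutB_uniform (e : OrthonormalBasis A ℂ (EuclideanSpace ℂ A))
    {ρ : Matrix (A × B × C) (A × B × C) ℂ} (hρ : IsState ρ) :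
    guessProb (measureA e (traceOutB ρ)) (uniformPOVM A C) = 1 / (Fintype.card A : ℝ) := by
  rw [guessProb_traceOutB]
  simp only [uniformPOVM, Matrix.kronecker_smul, Matrix.one_kronecker_one, guessEffect_uniform]
  rw [Matrix.mul_smul, mul_one, Matrix.trace_smul, hρ.2, smul_eq_mul, mul_one, Complex.ofReal_re]

theorem optGuessProb_traceOutC_mem [Nonempty A] (e : OrthonormalBasis A ℂ (EuclideanSpace ℂ A))
    {ρ : Matrix (A × B × C) (A × B × C) ℂ} (hρ : IsState ρ) :
    optGuessProb (measureA e (traceOutC ρ)) ∈ Set.Icc (1 / (Fintype.card A : ℝ)) 1 := by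
  have hub : ∀ p ∈ {p : ℝ | ∃ Λ, IsPOVM Λ ∧ guessProb (measureA e (traceOutC ρ)) Λ = p},
      p ≤ 1 := by
    rintro _ ⟨Λ, hΛ, rfl⟩
    exact (guessProb_traceOutC_mem e hρ hΛ).2
  have hmem : 1 / (Fintype.card A : ℝ) ∈
      {p : ℝ | ∃ Λ, IsPOVM Λ ∧ guessProb (measureA e (traceOutC ρ)) Λ = p} :=
    ⟨_, uniformPOVM_isPOVM, guessProb_traceOutC_uniform e hρ⟩
  exact ⟨le_csSup ⟨1, hub⟩ hmem, csSup_le ⟨_, hmem⟩ hub⟩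

theorem optGuessProb_traceOutB_mem [Nonempty A] (e : OrthonormalBasis A ℂ (EuclideanSpace ℂ A))
    {ρ : Matrix (A × B × C) (A × B × C) ℂ} (hρ : IsState ρ) :
    optGuessProb (measureA e (traceOutB ρ)) ∈ Set.Icc (1 / (Fintype.card A : ℝ)) 1 := by
  have hub : ∀ p ∈ {p : ℝ | ∃ Γ, IsPOVM Γ ∧ guessProb (measureA e (traceOutB ρ)) Γ = p},
      p ≤ 1 := by
    rintro _ ⟨Γ, hΓ, rfl⟩
    exact (guessProb_traceOutB_mem e hρ hΓ).2
  have hmem : 1 / (Fintype.card A : ℝ) ∈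
      {p : ℝ | ∃ Γ, IsPOVM Γ ∧ guessProb (measureA e (traceOutB ρ)) Γ = p} :=
    ⟨_, uniformPOVM_isPOVM, guessProb_traceOutB_uniform e hρ⟩
  exact ⟨le_csSup ⟨1, hub⟩ hmem, csSup_le ⟨_, hmem⟩ hub⟩

/-- The bound decreases in `p` on `[1/m, 1]`, so monotonicity cannot pass it to the supremum over
`Λ`. It is however a closed condition on `p`, and the supremum lies in the closure. -/
theorem optGuessProb_tradeoff [Nonempty A] {X Z : OrthonormalBasis A ℂ (EuclideanSpace ℂ A)}
    (hXZ : Conjugate X Z) {ρ : Matrix (A × B × C) (A × B × C) ℂ} (hρ : IsState ρ) :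
    (Fintype.card A : ℝ) * optGuessProb (measureA Z (traceOutB ρ)) ≤
      tradeoff (Fintype.card A) (optGuessProb (measureA X (traceOutC ρ))) := by
  have hm : (0 : ℝ) < Fintype.card A := one_pos.trans_le (one_le_card_real A)
  have huni : IsPOVM (uniformPOVM A B) := uniformPOVM_isPOVM
  have huniv := guessProb_traceOutC_uniform X hρ
  rw [← le_div_iff₀' hm]
  refine csSup_le ⟨_, uniformPOVM A C, uniformPOVM_isPOVM, rfl⟩ ?_
  rintro _ ⟨Γ, hΓ, rfl⟩
  rw [le_div_iff₀' hm]
  set q := guessProb (measureA Z (traceOutB ρ)) Γ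
  set S := {p : ℝ | ∃ Λ : A → Matrix B B ℂ,
    IsPOVM Λ ∧ guessProb (measureA X (traceOutC ρ)) Λ = p}
  -- The `max` covers measurements worse than blind guessing, where `uniformPOVM` is used instead.
  have hcl : IsClosed {p : ℝ | Fintype.card A * q ≤
      tradeoff (Fintype.card A) (max p (1 / (Fintype.card A : ℝ)))} := by
    refine isClosed_le continuous_const ?_
    unfold tradeoff
    fun_prop
  have hsub : S ⊆ {p : ℝ | Fintype.card A * q ≤
      tradeoff (Fintype.card A) (max p (1 / (Fintype.card A : ℝ)))} := by
    rintro _ ⟨Λ, hΛ, rfl⟩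
    rw [Set.mem_ofPred_eq]
    rcases le_total (1 / (Fintype.card A : ℝ)) (guessProb (measureA X (traceOutC ρ)) Λ) with h | h
    · rw [max_eq_left h]
      exact guessProb_tradeoff hXZ hρ hΛ hΓ h
    · rw [max_eq_right h, ← huniv]
      exact guessProb_tradeoff hXZ hρ huni hΓ huniv.ge
  have hbdd : BddAbove S := by
    refine ⟨1, ?_⟩
    rintro _ ⟨Λ, hΛ, rfl⟩
    exact (guessProb_traceOutC_mem X hρ hΛ).2
  have hmem := hcl.closure_subset_iff.2 hsub (csSup_mem_closure ⟨_, _, huni, rfl⟩ hbdd)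
  rw [Set.mem_ofPred_eq] at hmem
  rwa [max_eq_left] at hmem
  exact (optGuessProb_traceOutC_mem X hρ).1

end Tripartite

/-! ### States without side information -/

theorem constGuess_isPOVM {X B : Type*} [Fintype X] [DecidableEq X] [Fintype B] [DecidableEq B]
    (x₀ : X) : IsPOVM (constGuess x₀ : X → Matrix B B ℂ) := by
  refine ⟨fun x => ?_, by simp [constGuess]⟩
  unfold constGuess
  split_ifs
  exacts [Matrix.PosSemidef.one, Matrix.PosSemidef.zero]

/-- Without side information, guessing a most likely outcome is optimal. -/
theorem optGuessProb_of_unique {X B : Type*} [Fintype X] [DecidableEq X] [Unique B]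
    [Fintype B] [DecidableEq B] {ψ : X → Matrix B B ℂ} {w : X → ℝ} {x₀ : X}
    (hψ : ∀ x b b', ψ x b b' = (w x : ℂ)) (hw0 : ∀ x, w x ≤ w x₀) :
    guessProb ψ (constGuess x₀) = w x₀ ∧ optGuessProb ψ = w x₀ := by
  have hg : ∀ Λ : X → Matrix B B ℂ, guessProb ψ Λ = ∑ x, w x * (Λ x default default).re := by
    intro Λ
    simp [guessProb, Matrix.trace, Matrix.mul_apply, hψ]
  have hc : guessProb ψ (constGuess x₀) = w x₀ := by
    rw [hg, Finset.sum_eq_single x₀] <;> simp +contextual [constGuess]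
  refine ⟨hc, le_antisymm (csSup_le ⟨_, _, constGuess_isPOVM x₀, hc⟩ ?_) (le_csSup ⟨w x₀, ?_⟩
    ⟨_, constGuess_isPOVM x₀, hc⟩)⟩ <;>
  · rintro _ ⟨Λ, hΛ, rfl⟩
    have h1 : ∑ x, (Λ x default default).re = 1 := by
      have := congrFun (congrFun hΛ.2 default) default
      rw [Matrix.sum_apply, Matrix.one_apply_eq] at this
      rw [← Complex.re_sum, this, Complex.one_re]
    calc guessProb ψ Λ = ∑ x, w x * (Λ x default default).re := hg Λ
      _ ≤ ∑ x, w x₀ * (Λ x default default).re := Finset.sum_le_sum fun x _ =>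
          mul_le_mul_of_nonneg_right (hw0 x) (Complex.nonneg_iff.1 (hΛ.1 x).diag_nonneg).1
      _ = w x₀ := by rw [← Finset.mul_sum, h1, mul_one]

/-- The density matrix `|θ⟩⟨θ|`. -/
noncomputable def pureState {A : Type*} [Fintype A] (θ : EuclideanSpace ℂ A) : Matrix A A ℂ :=
  Matrix.of fun a a' => θ a * star (θ a')

theorem pureState_isState {A : Type*} [Fintype A] {θ : EuclideanSpace ℂ A} (hθ : ‖θ‖ = 1) :
    IsState (pureState θ) := by
  refine ⟨Matrix.posSemidef_vecMulVec_self_star (fun a => θ a), ?_⟩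
  have h : inner ℂ θ θ = ((1 : ℝ) : ℂ) := by rw [inner_self_eq_norm_sq_to_K, hθ]; simp
  rw [inner_eq_sum, Complex.ofReal_one] at h
  rw [← h]
  exact Finset.sum_congr rfl fun a _ => mul_comm _ _

/-- The probability `⟨e_x|σ|e_x⟩` of the outcome `x`. -/
noncomputable def outcomeProb {A : Type*} [Fintype A]
    (e : OrthonormalBasis A ℂ (EuclideanSpace ℂ A)) (σ : Matrix A A ℂ) (x : A) : ℂ :=
  ∑ a, ∑ a', star (e x a) * σ a a' * e x a'

theorem outcomeProb_pureState {A : Type*} [Fintype A]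
    (e : OrthonormalBasis A ℂ (EuclideanSpace ℂ A)) (θ : EuclideanSpace ℂ A) (x : A) :
    outcomeProb e (pureState θ) x = ((‖inner ℂ (e x) θ‖ ^ 2 : ℝ) : ℂ) := by
  have h : inner ℂ (e x) θ * inner ℂ θ (e x) = ((‖inner ℂ (e x) θ‖ ^ 2 : ℝ) : ℂ) := by
    rw [← inner_conj_symm θ (e x), Complex.mul_conj']
    norm_cast
  rw [← h, inner_eq_sum, inner_eq_sum, Finset.sum_mul_sum]
  refine Finset.sum_congr rfl fun a _ => Finset.sum_congr rfl fun a' _ => ?_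
  simp only [pureState, Matrix.of_apply]
  ring

/-- A state of `A` with trivial `B` and `C`. -/
def extendTrivially {A : Type*} (B C : Type*) (σ : Matrix A A ℂ) :
    Matrix (A × B × C) (A × B × C) ℂ :=
  σ.submatrix Prod.fst Prod.fst

section Unique

variable {A B C : Type*} [Fintype A] [Unique B] [Unique C] [Fintype B] [Fintype C]

theorem extendTrivially_isState {σ : Matrix A A ℂ} (hσ : IsState σ) :
    IsState (extendTrivially B C σ) := by
  refine ⟨hσ.1.submatrix _, ?_⟩
  rw [← hσ.2]
  simp [Matrix.trace, extendTrivially, Fintype.sum_prod_type]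

omit [Unique B] [Fintype B] in
theorem measureA_traceOutC_extendTrivially (e : OrthonormalBasis A ℂ (EuclideanSpace ℂ A))
    (σ : Matrix A A ℂ) (x : A) (b b' : B) :
    measureA e (traceOutC (extendTrivially B C σ)) x b b' = outcomeProb e σ x := by
  simp [measureA, traceOutC, extendTrivially, outcomeProb]

omit [Unique C] [Fintype C] in
theorem measureA_traceOutB_extendTrivially (e : OrthonormalBasis A ℂ (EuclideanSpace ℂ A))
    (σ : Matrix A A ℂ) (x : A) (c c' : C) :
    measureA e (traceOutB (extendTrivially B C σ)) x c c' = outcomeProb e σ x := by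
  simp [measureA, traceOutB, extendTrivially, outcomeProb]

end Unique

/-! ### The L distribution and its states -/

section LDist

variable {A : Type*} [Fintype A] [DecidableEq A]

/-- Valid also for a single outcome: the factor `card A - 1` is then zero, whatever the value of the
division by zero. -/
theorem sum_lDist_comp (x₀ : A) (p₀ : ℝ) (f : ℝ → ℝ) :
    ∑ x, f (lDist x₀ p₀ x) =
      f p₀ + ((Fintype.card A : ℝ) - 1) * f ((1 - p₀) / ((Fintype.card A : ℝ) - 1)) := by
  have hc : 1 ≤ Fintype.card A := Fintype.card_pos_iff.2 ⟨x₀⟩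
  rw [← Finset.add_sum_erase _ _ (Finset.mem_univ x₀), Finset.sum_congr rfl (g := fun _ =>
    f ((1 - p₀) / ((Fintype.card A : ℝ) - 1)))]
  · rw [Finset.sum_const, Finset.card_erase_of_mem (Finset.mem_univ _), Finset.card_univ,
      nsmul_eq_mul, Nat.cast_sub hc, Nat.cast_one, lDist, if_pos rfl]
  · intro x hx
    rw [lDist, if_neg (Finset.ne_of_mem_erase hx)]

omit [DecidableEq A] in
theorem card_sub_one_eq_zero_or_pos (x₀ : A) :
    (Fintype.card A : ℝ) = 1 ∨ 0 < (Fintype.card A : ℝ) - 1 := by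
  have : Nonempty A := ⟨x₀⟩
  rcases (one_le_card_real A).eq_or_lt with h | h
  exacts [Or.inl h.symm, Or.inr (sub_pos.2 h)]

variable {x₀ : A} {p₀ : ℝ} (hp : p₀ ∈ Set.Icc (1 / (Fintype.card A : ℝ)) 1)

theorem lDist_self : lDist x₀ p₀ x₀ = p₀ := if_pos rfl

include hp

theorem lDist_nonneg (x : A) : 0 ≤ lDist x₀ p₀ x := by
  have : Nonempty A := ⟨x⟩
  unfold lDist
  split_ifs
  · exact (by positivity : 0 ≤ 1 / (Fintype.card A : ℝ)).trans hp.1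
  · exact div_nonneg (sub_nonneg.2 hp.2) (sub_nonneg.2 (one_le_card_real A))

theorem lDist_le (x : A) : lDist x₀ p₀ x ≤ p₀ := by
  have : Nonempty A := ⟨x⟩
  have hm := one_le_card_real A
  have h0 : 0 ≤ p₀ := (by positivity : 0 ≤ 1 / (Fintype.card A : ℝ)).trans hp.1
  unfold lDist
  split_ifs
  · rfl
  · refine div_le_of_le_mul₀ (sub_nonneg.2 hm) h0 ?_
    have := mul_le_mul_of_nonneg_right hp.1 (by linarith : 0 ≤ (Fintype.card A : ℝ))
    rw [one_div_mul_cancel (by linarith)] at this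
    linarith

theorem sum_lDist : ∑ x, lDist x₀ p₀ x = 1 := by
  rw [sum_lDist_comp x₀ p₀ (fun t => t)]
  rcases card_sub_one_eq_zero_or_pos x₀ with h | h
  · rw [h] at hp ⊢
    have : p₀ = 1 := le_antisymm hp.2 (by simpa using hp.1)
    simp [this]
  · rw [mul_div_cancel₀ _ h.ne']
    ring

omit hp in
theorem sq_sum_sqrt_lDist : (∑ x, √(lDist x₀ p₀ x)) ^ 2 = tradeoff (Fintype.card A) p₀ := by
  rw [sum_lDist_comp x₀ p₀ (fun t => √t), tradeoff]
  rcases card_sub_one_eq_zero_or_pos x₀ with h | h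
  · simp [h]
  · rw [Real.sqrt_div' _ h.le, mul_div_assoc', mul_div_right_comm, Real.div_sqrt]

end LDist

section LState

variable {A : Type*} [Fintype A] [DecidableEq A]
  {X Z : OrthonormalBasis A ℂ (EuclideanSpace ℂ A)} {x₀ z₀ : A} {p₀ : ℝ}

theorem inner_lState (x : A) : inner ℂ (X x) (lState X Z x₀ z₀ p₀) =
    ((√(lDist x₀ p₀ x) : ℝ) : ℂ) * (((√(Fintype.card A : ℝ) : ℝ) : ℂ) * inner ℂ (X x) (Z z₀)) :=
  X.orthonormal.inner_right_fintype _ x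

variable (hXZ : Conjugate X Z)
include hXZ

omit [DecidableEq A] in
theorem Conjugate.norm_inner (x z : A) : ‖inner ℂ (X x) (Z z)‖ = 1 / √(Fintype.card A : ℝ) := by
  rw [← Real.sqrt_sq (norm_nonneg (inner ℂ (X x) (Z z))), hXZ x z,
    Real.sqrt_div zero_le_one, Real.sqrt_one]

theorem norm_inner_lState_sq (hp : p₀ ∈ Set.Icc (1 / (Fintype.card A : ℝ)) 1) (x : A) :
    ‖inner ℂ (X x) (lState X Z x₀ z₀ p₀)‖ ^ 2 = lDist x₀ p₀ x := by
  have : Nonempty A := ⟨x⟩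
  have hm : 0 < √(Fintype.card A : ℝ) := Real.sqrt_pos.2 (by positivity)
  rw [inner_lState, norm_mul, norm_mul, hXZ.norm_inner, Complex.norm_real, Complex.norm_real,
    Real.norm_of_nonneg (Real.sqrt_nonneg _), Real.norm_of_nonneg hm.le,
    mul_one_div_cancel hm.ne', mul_one, Real.sq_sqrt (lDist_nonneg hp x)]

theorem norm_lState (hp : p₀ ∈ Set.Icc (1 / (Fintype.card A : ℝ)) 1) :
    ‖lState X Z x₀ z₀ p₀‖ = 1 := by
  have h := X.sum_sq_norm_inner_right (lState X Z x₀ z₀ p₀)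
  simp_rw [norm_inner_lState_sq hXZ hp] at h
  rw [sum_lDist hp] at h
  exact (pow_eq_one_iff_of_nonneg (norm_nonneg _) two_ne_zero).1 h.symm

omit hXZ in
theorem inner_conjugate_lState (z : A) : inner ℂ (Z z) (lState X Z x₀ z₀ p₀) =
    ∑ x, ((√(lDist x₀ p₀ x) : ℝ) : ℂ) *
      (((√(Fintype.card A : ℝ) : ℝ) : ℂ) * inner ℂ (X x) (Z z₀)) * inner ℂ (Z z) (X x) := by
  simp only [lState, inner_sum, inner_smul_right]

theorem norm_inner_conjugate_lState_le (z : A) : ‖inner ℂ (Z z) (lState X Z x₀ z₀ p₀)‖ ≤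
    (∑ x, √(lDist x₀ p₀ x)) * (1 / √(Fintype.card A : ℝ)) := by
  have : Nonempty A := ⟨z⟩
  have hm : 0 < √(Fintype.card A : ℝ) := Real.sqrt_pos.2 (by positivity)
  rw [inner_conjugate_lState, Finset.sum_mul]
  refine norm_sum_le_of_le _ fun x _ => ?_
  rw [norm_mul, norm_mul, norm_mul, hXZ.norm_inner, norm_inner_symm, hXZ.norm_inner,
    Complex.norm_real, Complex.norm_real, Real.norm_of_nonneg (Real.sqrt_nonneg _),
    Real.norm_of_nonneg hm.le, mul_one_div_cancel hm.ne', mul_one]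

/-- The phases in `lState` cancel those of `⟨z₀|x⟩`, so all terms are nonnegative and the triangle
inequality of `norm_inner_conjugate_lState_le` is saturated. -/
theorem norm_inner_conjugate_lState_self : ‖inner ℂ (Z z₀) (lState X Z x₀ z₀ p₀)‖ =
    (∑ x, √(lDist x₀ p₀ x)) * (1 / √(Fintype.card A : ℝ)) := by
  have : Nonempty A := ⟨z₀⟩
  have hm : 0 < √(Fintype.card A : ℝ) := Real.sqrt_pos.2 (by positivity)
  have e : inner ℂ (Z z₀) (lState X Z x₀ z₀ p₀) =
      (((∑ x, √(lDist x₀ p₀ x)) * (1 / √(Fintype.card A : ℝ)) : ℝ) : ℂ) := by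
    rw [inner_conjugate_lState, Finset.sum_mul, Complex.ofReal_sum]
    refine Finset.sum_congr rfl fun x _ => ?_
    have h : inner ℂ (X x) (Z z₀) * inner ℂ (Z z₀) (X x) =
        (((1 / √(Fintype.card A : ℝ)) ^ 2 : ℝ) : ℂ) := by
      rw [← inner_conj_symm (Z z₀) (X x), Complex.mul_conj', hXZ.norm_inner]
      norm_cast
    rw [mul_assoc, mul_assoc, h, ← Complex.ofReal_mul, ← Complex.ofReal_mul]
    congr 1
    field_simp
  rw [e, Complex.norm_real, Real.norm_of_nonneg]
  exact mul_nonneg (Finset.sum_nonneg fun _ _ => Real.sqrt_nonneg _) (by positivity)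

omit hXZ in
/-- The mixture of the L state with its dephasing in the basis `X`. -/
noncomputable def dephasedLState (X Z : OrthonormalBasis A ℂ (EuclideanSpace ℂ A)) (x₀ z₀ : A)
    (p₀ t : ℝ) : Matrix A A ℂ :=
  (t : ℂ) • pureState (lState X Z x₀ z₀ p₀) +
    ((1 - t : ℝ) : ℂ) • ∑ y, ((lDist x₀ p₀ y : ℝ) : ℂ) • pureState (X y)

theorem dephasedLState_isState (hp : p₀ ∈ Set.Icc (1 / (Fintype.card A : ℝ)) 1) {t : ℝ}
    (ht : t ∈ Set.Icc (0 : ℝ) 1) : IsState (dephasedLState X Z x₀ z₀ p₀ t) := by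
  have h1 := pureState_isState (norm_lState (x₀ := x₀) (z₀ := z₀) hXZ hp)
  have h2 : ∀ y, IsState (pureState (X y)) := fun y => pureState_isState (X.orthonormal.1 y)
  refine ⟨(h1.1.smul ?_).add ((Matrix.posSemidef_sum _ fun y _ => (h2 y).1.smul ?_).smul ?_), ?_⟩
  · exact_mod_cast ht.1
  · exact_mod_cast lDist_nonneg hp y
  · exact_mod_cast sub_nonneg.2 ht.2
  · simp only [dephasedLState, Matrix.trace_add, Matrix.trace_smul, Matrix.trace_sum, h1.2,
      (h2 _).2, smul_eq_mul, mul_one, ← Complex.ofReal_sum, sum_lDist hp]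
    push_cast
    ring

omit hXZ in
theorem outcomeProb_dephasedLState (e : OrthonormalBasis A ℂ (EuclideanSpace ℂ A)) (t : ℝ)
    (x : A) : outcomeProb e (dephasedLState X Z x₀ z₀ p₀ t) x =
      ((t * ‖inner ℂ (e x) (lState X Z x₀ z₀ p₀)‖ ^ 2 +
        (1 - t) * ∑ y, lDist x₀ p₀ y * ‖inner ℂ (e x) (X y)‖ ^ 2 : ℝ) : ℂ) := by
  have hadd : ∀ σ τ, outcomeProb e (σ + τ) x = outcomeProb e σ x + outcomeProb e τ x := by
    intro σ τ
    simp [outcomeProb, mul_add, add_mul, Finset.sum_add_distrib]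
  have hsmul : ∀ (c : ℂ) σ, outcomeProb e (c • σ) x = c * outcomeProb e σ x := by
    intro c σ
    simp only [outcomeProb, Matrix.smul_apply, smul_eq_mul, Finset.mul_sum]
    exact Finset.sum_congr rfl fun _ _ => Finset.sum_congr rfl fun _ _ => by ring
  have hsum : ∀ f : A → Matrix A A ℂ, outcomeProb e (∑ y, f y) x = ∑ y, outcomeProb e (f y) x :=
    fun f => map_sum (⟨⟨fun σ => outcomeProb e σ x, by simp [outcomeProb]⟩, hadd⟩ :
      Matrix A A ℂ →+ ℂ) f Finset.univ
  rw [dephasedLState, hadd, hsmul, hsmul, hsum]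
  simp only [hsmul, outcomeProb_pureState]
  push_cast
  rfl

theorem outcomeProb_dephasedLState_fst (hp : p₀ ∈ Set.Icc (1 / (Fintype.card A : ℝ)) 1) (t : ℝ)
    (x : A) : outcomeProb X (dephasedLState X Z x₀ z₀ p₀ t) x = ((lDist x₀ p₀ x : ℝ) : ℂ) := by
  have h : ∀ y, ‖inner ℂ (X x) (X y)‖ ^ 2 = if x = y then 1 else 0 := by
    intro y
    rw [orthonormal_iff_ite.1 X.orthonormal x y]
    split_ifs <;> simp
  rw [outcomeProb_dephasedLState, norm_inner_lState_sq hXZ hp]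
  simp only [h, mul_ite, mul_one, mul_zero, Finset.sum_ite_eq, Finset.mem_univ, if_true]
  congr 1
  ring

/-- The dephased part is a mixture of `X` basis states, on each of which `Z` is uniform. Thus `t`
tunes the `Z` statistics alone. -/
theorem outcomeProb_dephasedLState_snd (hp : p₀ ∈ Set.Icc (1 / (Fintype.card A : ℝ)) 1) (t : ℝ)
    (z : A) : outcomeProb Z (dephasedLState X Z x₀ z₀ p₀ t) z =
      ((t * ‖inner ℂ (Z z) (lState X Z x₀ z₀ p₀)‖ ^ 2 +
        (1 - t) * (1 / (Fintype.card A : ℝ)) : ℝ) : ℂ) := by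
  rw [outcomeProb_dephasedLState]
  simp only [norm_inner_symm (Z z), hXZ _ z, ← Finset.sum_mul, sum_lDist hp, one_mul]

theorem optGuessProb_dephasedLState (B C : Type*) [Unique B] [Unique C] [Fintype B] [Fintype C]
    [DecidableEq B] [DecidableEq C] (hp : p₀ ∈ Set.Icc (1 / (Fintype.card A : ℝ)) 1) {t : ℝ}
    (ht : 0 ≤ t) {ρ : Matrix (A × B × C) (A × B × C) ℂ}
    (hρ : ρ = extendTrivially B C (dephasedLState X Z x₀ z₀ p₀ t)) :
    (guessProb (measureA X (traceOutC ρ)) (constGuess x₀) = p₀ ∧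
      optGuessProb (measureA X (traceOutC ρ)) = p₀) ∧
    (guessProb (measureA Z (traceOutB ρ)) (constGuess z₀) =
        t * (tradeoff (Fintype.card A) p₀ / Fintype.card A) +
          (1 - t) * (1 / (Fintype.card A : ℝ)) ∧
      optGuessProb (measureA Z (traceOutB ρ)) =
        t * (tradeoff (Fintype.card A) p₀ / Fintype.card A) +
          (1 - t) * (1 / (Fintype.card A : ℝ))) := by
  subst hρ
  have hz : ‖inner ℂ (Z z₀) (lState X Z x₀ z₀ p₀)‖ ^ 2 =
      tradeoff (Fintype.card A) p₀ / Fintype.card A := by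
    rw [norm_inner_conjugate_lState_self hXZ, mul_pow, sq_sum_sqrt_lDist, div_pow, one_pow,
      Real.sq_sqrt (Nat.cast_nonneg _), mul_one_div]
  constructor
  · have := optGuessProb_of_unique (x₀ := x₀)
      (ψ := measureA X (traceOutC (extendTrivially B C (dephasedLState X Z x₀ z₀ p₀ t))))
      (fun x b b' => (measureA_traceOutC_extendTrivially X _ x b b').trans
        (outcomeProb_dephasedLState_fst hXZ hp t x))
      (fun x => by rw [lDist_self]; exact lDist_le hp x)
    rwa [lDist_self] at this
  · have := optGuessProb_of_unique (x₀ := z₀)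
      (ψ := measureA Z (traceOutB (extendTrivially B C (dephasedLState X Z x₀ z₀ p₀ t))))
      (fun x b b' => (measureA_traceOutB_extendTrivially Z _ x b b').trans
        (outcomeProb_dephasedLState_snd hXZ hp t x))
      (fun z => by
        gcongr
        rw [norm_inner_conjugate_lState_self hXZ]
        exact norm_inner_conjugate_lState_le hXZ z)
    rwa [hz] at this

theorem exists_state_of_mem_tradeoffRegion (x₀ z₀ : A) {p : ℝ × ℝ}
    (hp : p ∈ tradeoffRegion (Fintype.card A)) :
    ∃ ρ : Matrix (A × Fin 1 × Fin 1) (A × Fin 1 × Fin 1) ℂ, IsState ρ ∧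
      (guessProb (measureA X (traceOutC ρ)) (constGuess x₀) = p.1 ∧
        optGuessProb (measureA X (traceOutC ρ)) = p.1) ∧
      (guessProb (measureA Z (traceOutB ρ)) (constGuess z₀) = p.2 ∧
        optGuessProb (measureA Z (traceOutB ρ)) = p.2) := by
  have : Nonempty A := ⟨x₀⟩
  have hm : (0 : ℝ) < Fintype.card A := by positivity
  obtain ⟨h1, h2, h3⟩ := hp
  obtain ⟨t, ht, hte⟩ : ∃ t ∈ Set.Icc (0 : ℝ) 1,
      t * (tradeoff (Fintype.card A) p.1 / Fintype.card A) +
        (1 - t) * (1 / (Fintype.card A : ℝ)) = p.2 := by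
    set w := tradeoff (Fintype.card A) p.1 / Fintype.card A
    have hw : p.2 ≤ w := (le_div_iff₀' hm).2 h3
    -- Linear interpolation from `1/m` at `t = 0` to `w` at `t = 1`; if these coincide, `p.2` equals
    -- both and `t = 0` serves.
    rcases (h2.1.trans hw).eq_or_lt with h | h
    · refine ⟨0, by simp, ?_⟩
      linarith [h2.1]
    · refine ⟨(p.2 - 1 / (Fintype.card A : ℝ)) / (w - 1 / (Fintype.card A : ℝ)),
        ⟨div_nonneg (sub_nonneg.2 h2.1) (sub_pos.2 h).le, ?_⟩, ?_⟩
      · rw [div_le_one (sub_pos.2 h)]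
        linarith
      · have h' := (sub_pos.2 h).ne'
        have := div_mul_cancel₀ (p.2 - 1 / (Fintype.card A : ℝ)) h'
        linarith
  have hopt := optGuessProb_dephasedLState (x₀ := x₀) (z₀ := z₀) hXZ (Fin 1) (Fin 1) h1 ht.1 rfl
  rw [hte] at hopt
  exact ⟨_, extendTrivially_isState (dephasedLState_isState hXZ h1 ht), hopt⟩

end LState

/-! ### Assembly -/

theorem mainTheorem5 {A : Type*} [Fintype A] [DecidableEq A] [Nonempty A]
    (X Z : OrthonormalBasis A ℂ (EuclideanSpace ℂ A)) (hXZ : Conjugate X Z) :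
    -- the bound, for every tripartite state
    (∀ (B : Type*) [Fintype B] [DecidableEq B] (C : Type*) [Fintype C] [DecidableEq C]
        (ρ : Matrix (A × B × C) (A × B × C) ℂ), IsState ρ →
        (Fintype.card A : ℝ) * optGuessProb (measureA Z (traceOutB ρ)) ≤
          (Real.sqrt (optGuessProb (measureA X (traceOutC ρ))) +
            Real.sqrt ((Fintype.card A : ℝ) - 1) *
              Real.sqrt (1 - optGuessProb (measureA X (traceOutC ρ)))) ^ 2) ∧
    -- equality for the L-distribution state, with the constant guesses being optimal
    (∀ (x₀ z₀ : A) (p₀ : ℝ), p₀ ∈ Set.Icc (1 / (Fintype.card A : ℝ)) 1 →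
        ∃ ρ, ρ = trivialExtension (lState X Z x₀ z₀ p₀) ∧ IsState ρ ∧
          guessProb (measureA X (traceOutC ρ)) (constGuess x₀) = p₀ ∧
          optGuessProb (measureA X (traceOutC ρ)) = p₀ ∧
          guessProb (measureA Z (traceOutB ρ)) (constGuess z₀) =
            optGuessProb (measureA Z (traceOutB ρ)) ∧
          (Fintype.card A : ℝ) * optGuessProb (measureA Z (traceOutB ρ)) =
            (Real.sqrt p₀ +
              Real.sqrt ((Fintype.card A : ℝ) - 1) * Real.sqrt (1 - p₀)) ^ 2) ∧
    -- with the usual phase convention this state has the amplitudes `√(lDist x)`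
    (∀ (x₀ z₀ : A) (p₀ : ℝ),
        (∀ x, inner ℂ (X x) (Z z₀) =
          ((1 / Real.sqrt (Fintype.card A : ℝ) : ℝ) : ℂ)) →
        lState X Z x₀ z₀ p₀ = ∑ x, ((Real.sqrt (lDist x₀ p₀ x) : ℝ) : ℂ) • X x) ∧
    -- the exact region of optimal guessing probabilities
    {p : ℝ × ℝ | ∃ (nB nC : ℕ)
        (ρ : Matrix (A × Fin nB × Fin nC) (A × Fin nB × Fin nC) ℂ), IsState ρ ∧
        p.1 = optGuessProb (measureA X (traceOutC ρ)) ∧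
        p.2 = optGuessProb (measureA Z (traceOutB ρ))} =
      tradeoffRegion (Fintype.card A : ℝ) ∧
    -- the same region for arbitrary measurements that are not worse than blind guessing
    {p : ℝ × ℝ | 1 / (Fintype.card A : ℝ) ≤ p.1 ∧ 1 / (Fintype.card A : ℝ) ≤ p.2 ∧
        ∃ (nB nC : ℕ) (ρ : Matrix (A × Fin nB × Fin nC) (A × Fin nB × Fin nC) ℂ)
          (Λ : A → Matrix (Fin nB) (Fin nB) ℂ) (Γ : A → Matrix (Fin nC) (Fin nC) ℂ),
        IsState ρ ∧ IsPOVM Λ ∧ IsPOVM Γ ∧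
        p.1 = guessProb (measureA X (traceOutC ρ)) Λ ∧
        p.2 = guessProb (measureA Z (traceOutB ρ)) Γ} =
      tradeoffRegion (Fintype.card A : ℝ) ∧
    -- the boundary is the upper right arc of the ellipse, which bounds the region
    (2 ≤ Fintype.card A →
      tradeoffBoundary (Fintype.card A : ℝ) =
        {p | p.1 ∈ Set.Icc (1 / (Fintype.card A : ℝ)) 1 ∧
          p.2 ∈ Set.Icc (1 / (Fintype.card A : ℝ)) 1 ∧ 1 ≤ p.1 + p.2 ∧
          p ∈ tradeoffEllipse (Fintype.card A : ℝ)} ∧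
      tradeoffRegion (Fintype.card A : ℝ) =
        {p | p.1 ∈ Set.Icc (1 / (Fintype.card A : ℝ)) 1 ∧
          p.2 ∈ Set.Icc (1 / (Fintype.card A : ℝ)) 1 ∧
          (p.1 + p.2 ≤ 1 ∨ ellipseForm (Fintype.card A : ℝ) p ≤ 1)}) ∧
    -- these are precisely the ellipses that just fit in the unit square
    (∀ E : Set (ℝ × ℝ), (IsEllipse E ∧ JustFitsUnitSquare E) ↔
      ∃ m : ℝ, 1 < m ∧ E = tradeoffEllipse m) := by
  refine ⟨fun B _ _ C _ _ ρ hρ => optGuessProb_tradeoff hXZ hρ, ?_, ?_, ?_, ?_, ?_,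
    isEllipse_and_justFits_iff⟩
  · intro x₀ z₀ p₀ hp
    have hm : (Fintype.card A : ℝ) ≠ 0 := Nat.cast_ne_zero.2 Fintype.card_ne_zero
    -- The pure L state is the undephased case `t = 1`.
    have hρ : trivialExtension (lState X Z x₀ z₀ p₀) =
        extendTrivially Unit Unit (dephasedLState X Z x₀ z₀ p₀ 1) := by
      have : dephasedLState X Z x₀ z₀ p₀ 1 = pureState (lState X Z x₀ z₀ p₀) := by
        simp [dephasedLState]
      rw [this]
      rfl
    obtain ⟨⟨h1, h2⟩, h3, h4⟩ := optGuessProb_dephasedLState hXZ Unit Unit hp zero_le_one hρ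
    refine ⟨_, rfl, ?_, h1, h2, h3.trans h4.symm, ?_⟩
    · rw [hρ]
      exact extendTrivially_isState (dephasedLState_isState hXZ hp (by simp))
    · rw [h4, sub_self, zero_mul, add_zero, one_mul, mul_div_cancel₀ _ hm]
      rfl
  · intro x₀ z₀ p₀ h
    have hm : √(Fintype.card A : ℝ) ≠ 0 :=
      (Real.sqrt_pos.2 (Nat.cast_pos.2 Fintype.card_pos)).ne'
    simp only [lState, h, ← Complex.ofReal_mul, mul_one_div_cancel hm, mul_one]
  · ext p
    constructor
    · rintro ⟨nB, nC, ρ, hρ, h1, h2⟩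
      have hX := optGuessProb_traceOutC_mem X hρ
      have hZ := optGuessProb_traceOutB_mem Z hρ
      have hT := optGuessProb_tradeoff hXZ hρ
      rw [← h1] at hX hT
      rw [← h2] at hZ hT
      exact ⟨hX, hZ, hT⟩
    · intro hp
      obtain ⟨ρ, hρ, h1, h2⟩ := exists_state_of_mem_tradeoffRegion hXZ
        (Classical.arbitrary A) (Classical.arbitrary A) hp
      exact ⟨1, 1, ρ, hρ, h1.2.symm, h2.2.symm⟩
  · ext p
    constructor
    · rintro ⟨hp1, hp2, nB, nC, ρ, Λ, Γ, hρ, hΛ, hΓ, h1, h2⟩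
      have hX := (guessProb_traceOutC_mem X hρ hΛ).2
      have hZ := (guessProb_traceOutB_mem Z hρ hΓ).2
      have hT := guessProb_tradeoff hXZ hρ hΛ hΓ (h1 ▸ hp1)
      rw [← h1] at hX hT
      rw [← h2] at hZ hT
      exact ⟨⟨hp1, hX⟩, ⟨hp2, hZ⟩, hT⟩
    · intro hp
      obtain ⟨ρ, hρ, h1, h2⟩ := exists_state_of_mem_tradeoffRegion hXZ
        (Classical.arbitrary A) (Classical.arbitrary A) hp
      exact ⟨hp.1.1, hp.2.1.1, 1, 1, ρ, _, _, hρ, constGuess_isPOVM _, constGuess_isPOVM _,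
        h1.1.symm, h2.1.symm⟩
  · intro hm
    have hm' : (2 : ℝ) ≤ Fintype.card A := by exact_mod_cast hm
    exact ⟨tradeoffBoundary_eq hm', tradeoffRegion_eq hm'⟩
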